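/- Let $n\ge 1$, $\lambda>0$, $p>1$, and let $N^1,\dots,N^n$ be independent Poisson processes with intensity $\lambda$ (started at $0$, with almost surely nondecreasing right-continuous paths). Define the multiply iterated Poisson process by $V^{(0)}_t=t$ and $V^{(m)}_t=N^m\big(V^{(m-1)}_t\big)$ for $1\le m\le n$, $t\ge 0$, and put $$J_p^{(n)}=\int_0^\infty \big(V^{(n)}_t+1\big)^{-p}\,dt .$$ For $0\le m\le n-1$ and $k\in\mathbb{Z}_{\ge 0}$ let $q_m(k)=\mathsf P\{V^{(m)}_1=k\}$, and let $\pi=\mathsf P\{V^{(n-1)}_1\ge 1\}$. Then $q_0(k)=1$ if $k=1$ and $q_0(k)=0$ otherwise, and $$q_{m+1}(k)=\frac{\lambda^k}{k!}\sum_{j=0}^\infty j^k e^{-\lambda j}q_m(j)\qquad (0\le m<n-1,\ k\ge 0,\ 0^0=1);$$ moreover $\pi>0$, and $J_p^{(n)}$ is a random variable that is almost surely finite. Write $q=q_{n-1}$ and, for positive integers $z_1,\dots,z_K$, write $s_k=z_1+\dots+z_{k-1}+1$ $(1\le k\le K)$. (i) For every $u\in\mathbb{C}$ with $\operatorname{Re}u>-\lambda\pi$,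 the variable $e^{-uJ_p^{(n)}}$ is integrable and $$\mathsf E\,e^{-uJ_p^{(n)}}=\lim_{K\to\infty}\pi^{-K}\sum_{z_1,\dots,z_K\ge 1}\Big(\prod_{k=1}^K q(z_k)\Big)\prod_{k=1}^K\Big(1+\frac{u}{\lambda\pi s_k^{\,p}}\Big)^{-1},$$ where each $K$-fold series converges absolutely. (ii) $J_p^{(n)}$ is concentrated on $(0,\infty)$ and has a probability density function $\psi$ on $(0,\infty)$ such that for every $x>0$ $$\psi(x)=\lambda\lim_{K\to\infty}\pi^{1-K}\sum_{z_1,\dots,z_K\ge 1}\Big(\prod_{k=1}^K q(z_k)\Big)\sum_{k_1=1}^K s_{k_1}^{\,p}\,e^{-\lambda\pi s_{k_1}^{\,p}x}\prod_{\substack{k_2=1\\k_2\ne k_1}}^K\Big(1-\Big(\frac{s_{k_1}}{s_{k_2}}\Big)^{p}\Big)^{-1},$$ where each $K$-fold series, with the finite sum over $k_1$ kept as part of the summand, converges absolutely. -/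

import Mathlib

open MeasureTheory ProbabilityTheory Filter Topology Set
open scoped NNReal ENNReal

noncomputable section

/-- `X` is a (homogeneous) Poisson process with intensity `lam` under `P`: it starts at `0`, has
independent increments, its increment over `[s, t]` is Poisson distributed with parameter
`lam * (t - s)`, and its paths are almost surely nondecreasing and right-continuous.  Since the
paths are nondecreasing, the truncated difference `X t - X s` of natural numbers, `s ≤ t`, is
almost surely the true increment. -/
structure IsPoissonProcess {Ω : Type*} [MeasurableSpace Ω] (X : ℝ≥0 → Ω → ℕ) (lam : ℝ≥0)
    (P : Measure Ω) : Prop where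
  measurable : ∀ t, Measurable (X t)
  start_zero : ∀ᵐ ω ∂P, X 0 ω = 0
  indep_increments : HasIndepIncrements X P
  law_increments : ∀ s t : ℝ≥0, s ≤ t →
    HasLaw (fun ω => X t ω - X s ω) (poissonMeasure (lam * (t - s))) P
  monotone_paths : ∀ᵐ ω ∂P, Monotone (fun t => X t ω)
  rightContinuous_paths : ∀ᵐ ω ∂P, ∀ t : ℝ≥0, ContinuousWithinAt (fun s => X s ω) (Ici t) t

/-- The iterated process `V^{(n)}` built from `N 0, …, N (n - 1)`:
`V^{(0)}_t = t` and `V^{(n+1)}_t = N_n (V^{(n)}_t)`; so `V^{(1)} = N 0`, `V^{(2)}_t = N_1 (N_0 t)`,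
and so on. -/
def iteratedProcess {Ω : Type*} (N : ℕ → ℝ≥0 → Ω → ℕ) : ℕ → ℝ≥0 → Ω → ℝ≥0
  | 0, t, _ => t
  | n + 1, t, ω => (N n (iteratedProcess N n t ω) ω : ℝ≥0)

/-- The inverse-power functional `J_p^{(n)} = ∫_0^∞ (V^{(n)}_t + 1)^{-p} dt`. -/
def inversePowerFunctional {Ω : Type*} (N : ℕ → ℝ≥0 → Ω → ℕ) (n : ℕ) (p : ℝ) (ω : Ω) : ℝ :=
  ∫ t in Ioi (0 : ℝ), ((iteratedProcess N n t.toNNReal ω : ℝ) + 1) ^ (-p)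

/-- `P{Z^{(m)} = k}`, where `Z^{(m)}` has the law of `V^{(m)}_1`. -/
def jumpProb {Ω : Type*} [MeasurableSpace Ω] (N : ℕ → ℝ≥0 → Ω → ℕ) (P : Measure Ω)
    (m k : ℕ) : ℝ :=
  P.real {ω | iteratedProcess N m 1 ω = (k : ℝ≥0)}

/-- `P{Z^{(m)} ≥ 1}`, where `Z^{(m)}` has the law of `V^{(m)}_1`. -/
def jumpProbPos {Ω : Type*} [MeasurableSpace Ω] (N : ℕ → ℝ≥0 → Ω → ℕ) (P : Measure Ω)
    (m : ℕ) : ℝ :=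
  P.real {ω | 1 ≤ iteratedProcess N m 1 ω}

/-- `z_1 + ⋯ + z_{k-1} + 1`: one plus the sum of the entries of `z` strictly before `k`. -/
def level {K : ℕ} (z : Fin K → ℕ+) (k : Fin K) : ℝ :=
  (∑ j ∈ Finset.Iio k, (z j : ℝ)) + 1

/-- The summand, at the jump sizes `z`, of the `K`-fold sum for the Laplace transform at `u`;
`q k = P{Z = k}` and `r = P{Z ≥ 1}`. -/
def laplaceTerm (lam : ℝ≥0) (q : ℕ → ℝ) (r p : ℝ) (u : ℂ) {K : ℕ} (z : Fin K → ℕ+) : ℂ :=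
  ((∏ k, q (z k) : ℝ) : ℂ) *
    ∏ k, (1 + u / ((lam * r * level z k ^ p : ℝ) : ℂ))⁻¹

/-- The summand, at the jump sizes `z`, of the `K`-fold sum for the density at `x`;
`q k = P{Z = k}` and `r = P{Z ≥ 1}`. -/
def densityTerm (lam : ℝ≥0) (q : ℕ → ℝ) (r p x : ℝ) {K : ℕ} (z : Fin K → ℕ+) : ℝ :=
  (∏ k, q (z k)) *
    ∑ k₁, level z k₁ ^ p * Real.exp (-(lam * r * level z k₁ ^ p * x)) *
      ∏ k₂ ∈ Finset.univ.erase k₁, (1 - (level z k₁ / level z k₂) ^ p)⁻¹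

end

/-! The process `V = V^{(n)}` is nondecreasing, integer valued, with stationary independent
increments. Its innermost Poisson process jumps at rate `λ`, and each such jump gives one unit of
time to the other `n - 1` processes, so `V` then moves by an amount of law `q`, possibly zero. Once
null moves are discarded, holding times are exponential of rate `λπ` and jumps are i.i.d. of law `q
/ π`. Given the jumps, `J` is therefore a sum of independent exponentials of rates `λπ s_k ^ p`.
Truncated to `K` levels, the product in (i) is the Laplace transform of that sum, the sum over `k₁`
in (ii) is (up to `λπ`) its hypoexponential density, and `π⁻ᴷ` normalises `q`.

The jump chain is never extracted from the paths. For `Re u ≥ 0` let `Φ a = E exp (-u ∫ (V + a)⁻ᵖ)`.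
Riemann sums of the functional satisfy an exact one-step equation (`integral_levelRiemannSum_eq`).
Dividing by the step and letting it tend to zero, with `tendsto_integral_compositeLaw`, yields the
generator equation `mul_integral_levelFunctional`. Solved for `Φ a` and iterated along a random walk
(`integral_prod_walk`), with `Φ a → 1` as `a → ∞`, it gives the limit formula
`tendsto_integral_prod_jumpRate`.

Independently, `exists_mixtureDensity` shows that hypoexponential densities averaged over the jumps
converge pointwise to some `ψ`, dominated by `C exp (-γ x)` for any `0 ≤ γ < λπ`. The estimates come
from the equation `f_{K+1}' = r_K (f_K - f_{K+1})`. The two limits agree on the imaginary axis, so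
`J` has density `ψ`; the decay of `ψ` then gives the transform on all of `Re u > -λπ`. The condition
`p > 1` enters through convergence of `∑ k⁻ᵖ`. -/

/-! ### Hypoexponential densities -/

/-- The partial fraction coefficient of `∏ k < K, (1 + u / r k)⁻¹` at `(1 + u / r k)⁻¹`. -/
noncomputable def hypoCoeff (r : ℕ → ℝ) (K k : ℕ) : ℝ :=
  ∏ j ∈ (Finset.range K).erase k, (1 - r k / r j)⁻¹

/-- The density of a sum of `K` independent exponential variables with rates
`r 0, …, r (K - 1)`. -/
noncomputable def hypoDensity (r : ℕ → ℝ) (K : ℕ) (x : ℝ) : ℝ :=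
  ∑ k ∈ Finset.range K, r k * Real.exp (-(r k * x)) * hypoCoeff r K k

section Hypoexponential

variable {r : ℕ → ℝ}

lemma hypoCoeff_succ {K k : ℕ} (hk : k < K) :
    hypoCoeff r (K + 1) k = hypoCoeff r K k * (1 - r k / r K)⁻¹ := by
  have h : (Finset.range (K + 1)).erase k = insert K ((Finset.range K).erase k) := by
    ext j; simp only [Finset.mem_erase, Finset.mem_range, Finset.mem_insert]; omega
  rw [hypoCoeff, h, Finset.prod_insert (by simp), mul_comm, hypoCoeff]

/-- Adding a rate convolves with an exponential density, which is this relaxation equation. It is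
checked termwise from `hypoCoeff_succ`; positivity and all later bounds on the densities use it in
place of probability. -/
lemma hasDerivAt_hypoDensity_succ (hpos : ∀ k, 0 < r k) (hr : StrictMono r) (K : ℕ) (x : ℝ) :
    HasDerivAt (hypoDensity r (K + 1)) (r K * (hypoDensity r K x - hypoDensity r (K + 1) x)) x := by
  have h : HasDerivAt (hypoDensity r (K + 1)) (∑ k ∈ Finset.range (K + 1),
      r k * (Real.exp (-(r k * x)) * (-(r k * 1))) * hypoCoeff r (K + 1) k) x := by
    unfold hypoDensity
    refine HasDerivAt.fun_sum fun k _ => ?_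
    exact (((((hasDerivAt_id x).const_mul (r k)).neg).exp).const_mul (r k)).mul_const _
  convert h using 1
  rw [Finset.sum_range_succ, hypoDensity, hypoDensity, Finset.sum_range_succ, ← sub_sub,
    ← Finset.sum_sub_distrib, mul_sub, Finset.mul_sum]
  rw [sub_eq_add_neg]
  congr 1
  · refine Finset.sum_congr rfl fun k hk => ?_
    rw [hypoCoeff_succ (Finset.mem_range.1 hk)]
    have h1 : r k < r K := hr (Finset.mem_range.1 hk)
    have h2 := (hpos K).ne'
    have h3 : r K - r k ≠ 0 := by linarith
    have h4 : (1 - r k / r K)⁻¹ = r K / (r K - r k) := by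
      field_simp
    rw [h4]
    field_simp
    ring
  · ring

/-- The Lagrange basis polynomials at the nodes `v k` sum to `1`; evaluate at `-u` and multiply by
the full product. -/
lemma sum_prod_erase_partialFraction {F : Type*} [Field F] {K : ℕ} (v : ℕ → F)
    (hv : Function.Injective v) (hv0 : ∀ k, v k ≠ 0) (u : F)
    (hu : ∀ k, 1 + u / v k ≠ 0) :
    ∑ k ∈ Finset.range (K + 1), (∏ j ∈ (Finset.range (K + 1)).erase k, (1 - v k / v j)⁻¹) *
      (1 + u / v k)⁻¹ = ∏ k ∈ Finset.range (K + 1), (1 + u / v k)⁻¹ := by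
  have h := congrArg (Polynomial.eval (-u)) (Lagrange.sum_basis (s := Finset.range (K + 1))
    hv.injOn ⟨0, by simp⟩)
  rw [Polynomial.eval_finsetSum, Polynomial.eval_one] at h
  have h2 : ∀ k ∈ Finset.range (K + 1), (∏ j ∈ (Finset.range (K + 1)).erase k,
      (1 - v k / v j)⁻¹) * (1 + u / v k)⁻¹ = (∏ k ∈ Finset.range (K + 1), (1 + u / v k)⁻¹) *
      Polynomial.eval (-u) (Lagrange.basis (Finset.range (K + 1)) v k) := by
    intro k hk
    rw [← Finset.prod_erase_mul _ _ hk, Lagrange.basis, Polynomial.eval_prod, mul_right_comm,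
      ← Finset.prod_mul_distrib]
    congr 1
    refine Finset.prod_congr rfl fun j hj => ?_
    have h3 : v k - v j ≠ 0 := sub_ne_zero.2 (hv.ne (Finset.ne_of_mem_erase hj).symm)
    have h5 : v j - v k ≠ 0 := sub_ne_zero.2 (hv.ne (Finset.ne_of_mem_erase hj))
    have h4 := hu j
    have h6 := hv0 j
    have h7 : v j + u ≠ 0 := by
      intro h0; apply h4; field_simp; rw [h0, mul_zero]
    rw [Lagrange.basisDivisor]
    simp only [Polynomial.eval_mul, Polynomial.eval_C, Polynomial.eval_sub, Polynomial.eval_X]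
    have e1 : (1 - v k / v j)⁻¹ = v j / (v j - v k) := by field_simp
    have e2 : (1 + u / v j)⁻¹ = v j / (v j + u) := by field_simp
    rw [e1, e2]
    field_simp
    ring
  rw [Finset.sum_congr rfl h2, ← Finset.mul_sum, h, mul_one]

/-- Multiply the partial fraction identity by `u` and let `u → ∞`. One factor of the product absorbs
`u`; with at least two rates, another factor remains and tends to zero. -/
lemma hypoDensity_zero_right (hpos : ∀ k, 0 < r k) (hr : StrictMono r) (K : ℕ) :
    hypoDensity r (K + 2) 0 = 0 := by
  have hfac : ∀ k, Tendsto (fun u : ℝ => u * (1 + u / r k)⁻¹) atTop (𝓝 (r k)) := by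
    intro k
    have h1 : Tendsto (fun u : ℝ => (u⁻¹ + (r k)⁻¹)⁻¹) atTop (𝓝 (0 + (r k)⁻¹)⁻¹) :=
      (tendsto_inv_atTop_zero.add_const _).inv₀ (by simpa using (hpos k).ne')
    rw [zero_add, inv_inv] at h1
    refine h1.congr' ?_
    filter_upwards [eventually_gt_atTop 0] with u hu
    have := hpos k
    field_simp
  have hz : ∀ k, Tendsto (fun u : ℝ => (1 + u / r k)⁻¹) atTop (𝓝 0) := fun k =>
    tendsto_inv_atTop_zero.comp
      (tendsto_atTop_add_const_left _ _ (tendsto_id.atTop_div_const (hpos k)))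
  have hl : Tendsto (fun u : ℝ => ∑ k ∈ Finset.range (K + 2), hypoCoeff r (K + 2) k *
      (u * (1 + u / r k)⁻¹)) atTop (𝓝 (∑ k ∈ Finset.range (K + 2), hypoCoeff r (K + 2) k * r k)) :=
    tendsto_finsetSum _ fun k _ => (hfac k).const_mul _
  have hr' : Tendsto (fun u : ℝ => (∏ k ∈ Finset.range (K + 1), (1 + u / r k)⁻¹) *
      (u * (1 + u / r (K + 1))⁻¹)) atTop (𝓝 ((∏ k ∈ Finset.range (K + 1), (0 : ℝ)) * r (K + 1))) :=
    (tendsto_finsetProd _ fun k _ => hz k).mul (hfac _)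
  have he := tendsto_nhds_unique_of_eventuallyEq hl hr' (by
    filter_upwards [eventually_gt_atTop 0] with u hu
    have h := sum_prod_erase_partialFraction (K := K + 1) r hr.injective (fun k => (hpos k).ne') u
      (fun k => by have := div_pos hu (hpos k); positivity)
    rw [Finset.prod_range_succ] at h
    have h' := congrArg (fun t => u * t) h
    simp only [Finset.mul_sum] at h'
    convert h' using 1
    · exact Finset.sum_congr rfl fun k _ => by rw [hypoCoeff]; ring
    · ring)
  rw [hypoDensity]
  simp only [Finset.prod_const, Finset.card_range] at he
  rw [zero_pow (Nat.succ_ne_zero _), zero_mul] at he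
  refine Eq.trans (Finset.sum_congr rfl fun k _ => ?_) he
  simp [mul_comm]

/-- Comparison principle: `exp (ρ x) (G x - B)` has derivative `ρ exp (ρ x) (φ x - B) ≤ 0`. -/
lemma le_of_hasDerivAt_relaxation {ρ B : ℝ} (hρ : 0 < ρ) {G φ : ℝ → ℝ}
    (hG : ∀ x, HasDerivAt G (ρ * (φ x - G x)) x) (h0 : G 0 ≤ B) (hφ : ∀ x, 0 ≤ x → φ x ≤ B)
    {x : ℝ} (hx : 0 ≤ x) : G x ≤ B := by
  have hd : ∀ y, HasDerivAt (fun y => Real.exp (ρ * y) * (G y - B))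
      (Real.exp (ρ * y) * (ρ * 1) * (G y - B) + Real.exp (ρ * y) * (ρ * (φ y - G y))) y :=
    fun y => (((hasDerivAt_id y).const_mul ρ).exp).mul ((hG y).sub_const B)
  have hanti : AntitoneOn (fun y => Real.exp (ρ * y) * (G y - B)) (Ici 0) := by
    refine antitoneOn_of_deriv_nonpos (convex_Ici 0)
      (fun y _ => (hd y).continuousAt.continuousWithinAt)
      (fun y _ => (hd y).differentiableAt.differentiableWithinAt) fun y hy => ?_
    rw [interior_Ici] at hy
    rw [(hd y).deriv]
    have h1 := hφ y (le_of_lt hy)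
    have h2 : Real.exp (ρ * y) * (ρ * 1) * (G y - B) + Real.exp (ρ * y) * (ρ * (φ y - G y)) =
      -(Real.exp (ρ * y) * ρ * (B - φ y)) := by ring
    rw [h2, neg_nonpos]
    exact mul_nonneg (by positivity) (by linarith)
  have h := hanti self_mem_Ici hx hx
  simp only [mul_zero, Real.exp_zero, one_mul] at h
  have h3 : Real.exp (ρ * x) * (G x - B) ≤ 0 := by linarith
  have h4 := (mul_nonpos_iff_pos_imp_nonpos.1 h3).1 (Real.exp_pos _)
  linarith

lemma ge_of_hasDerivAt_relaxation {ρ B : ℝ} (hρ : 0 < ρ) {G φ : ℝ → ℝ}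
    (hG : ∀ x, HasDerivAt G (ρ * (φ x - G x)) x) (h0 : B ≤ G 0) (hφ : ∀ x, 0 ≤ x → B ≤ φ x)
    {x : ℝ} (hx : 0 ≤ x) : B ≤ G x := by
  have h := le_of_hasDerivAt_relaxation (G := fun x => -G x) (φ := fun x => -φ x) (B := -B) hρ
    (fun y => (hG y).neg.congr_deriv (by ring)) (by simpa using h0)
    (fun y hy => by simpa using hφ y hy) hx
  linarith

lemma hypoDensity_one (x : ℝ) : hypoDensity r 1 x = r 0 * Real.exp (-(r 0 * x)) := by
  simp [hypoDensity, hypoCoeff]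

lemma hypoDensity_nonneg (hpos : ∀ k, 0 < r k) (hr : StrictMono r) (K : ℕ) {x : ℝ} (hx : 0 ≤ x) :
    0 ≤ hypoDensity r K x := by
  cases K with
  | zero => simp [hypoDensity]
  | succ K =>
    induction K generalizing x with
    | zero => rw [hypoDensity_one]; have := hpos 0; positivity
    | succ K ih =>
      exact ge_of_hasDerivAt_relaxation (hpos (K + 1))
        (hasDerivAt_hypoDensity_succ hpos hr (K + 1)) (hypoDensity_zero_right hpos hr K).ge
        (fun y hy => ih hy) hx

/-- The exponentially weighted density relaxes at rate `r (K + 1) - c` towards `(1 - c / r (K +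
1))⁻¹` times its predecessor, so each new rate costs exactly that factor in the bound. -/
lemma exp_mul_hypoDensity_le (hpos : ∀ k, 0 < r k) (hr : StrictMono r) {c : ℝ} (hc : c < r 0)
    (K : ℕ) {x : ℝ} (hx : 0 ≤ x) :
    Real.exp (c * x) * hypoDensity r (K + 1) x ≤
      r 0 * ∏ j ∈ Finset.range K, (1 - c / r (j + 1))⁻¹ := by
  have hcj : ∀ j, 0 < r j - c := fun j => by have := hr.monotone (Nat.zero_le j); linarith
  induction K generalizing x with
  | zero =>
    rw [hypoDensity_one, Finset.range_zero, Finset.prod_empty, mul_one, mul_left_comm,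
      ← Real.exp_add]
    refine mul_le_of_le_one_right (hpos 0).le (Real.exp_le_one_iff.2 ?_)
    have := mul_nonneg (hcj 0).le hx
    linarith
  | succ K ih =>
    have e : (1 - c / r (K + 1))⁻¹ = r (K + 1) / (r (K + 1) - c) := by
      have := hcj (K + 1); have := hpos (K + 1); field_simp
    have hB : 0 ≤ r 0 * ∏ j ∈ Finset.range K, (1 - c / r (j + 1))⁻¹ := by
      refine mul_nonneg (hpos 0).le (Finset.prod_nonneg fun j _ => ?_)
      rw [inv_nonneg, sub_nonneg, div_le_one (hpos _)]
      linarith [hcj (j + 1)]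
    rw [Finset.prod_range_succ, ← mul_assoc]
    refine le_of_hasDerivAt_relaxation (ρ := r (K + 1) - c) (hcj _)
      (G := fun x => Real.exp (c * x) * hypoDensity r (K + 1 + 1) x)
      (φ := fun x => Real.exp (c * x) * hypoDensity r (K + 1) x * (1 - c / r (K + 1))⁻¹)
      (fun y => ?_) ?_ (fun y hy => ?_) hx
    · refine ((((hasDerivAt_id y).const_mul c).exp).mul
        (hasDerivAt_hypoDensity_succ hpos hr (K + 1) y)).congr_deriv ?_
      rw [e]
      have := (hcj (K + 1)).ne'
      simp only [id]
      field_simp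
      ring
    · simp only [hypoDensity_zero_right hpos hr, mul_zero]
      refine mul_nonneg hB ?_
      rw [e]; exact (div_pos (hpos _) (hcj _)).le
    · refine mul_le_mul_of_nonneg_right (ih hy) ?_
      rw [e]; exact (div_pos (hpos _) (hcj _)).le

/-- The derivatives `r (K + 1) * (f (K + 1) - f (K + 2))` obey the same relaxation recursion and all
but the first vanish at `0`, so the bound `r 0 * r 1` on the first one propagates to all. -/
lemma abs_hypoDensity_succ_sub_le (hpos : ∀ k, 0 < r k) (hr : StrictMono r) (K : ℕ) {x : ℝ}
    (hx : 0 ≤ x) :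
    |hypoDensity r (K + 2) x - hypoDensity r (K + 1) x| ≤ r 0 * r 1 / r (K + 1) := by
  have hD : ∀ K, ∀ x, 0 ≤ x →
      |r (K + 1) * (hypoDensity r (K + 1) x - hypoDensity r (K + 2) x)| ≤ r 0 * r 1 := by
    intro K
    induction K with
    | zero =>
      intro x hx
      have h1 : ∀ y, 0 ≤ y → hypoDensity r 1 y ≤ r 0 := fun y hy => by
        simpa using exp_mul_hypoDensity_le hpos hr (hpos 0) 0 hy
      have h2 := le_of_hasDerivAt_relaxation (B := r 0) (hpos 1)
        (hasDerivAt_hypoDensity_succ hpos hr 1)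
        ((hypoDensity_zero_right hpos hr 0).le.trans (hpos 0).le) h1 hx
      have h3 := h1 x hx
      have h4 := hypoDensity_nonneg hpos hr 1 hx
      have h5 := hypoDensity_nonneg hpos hr 2 hx
      rw [abs_mul, abs_of_pos (hpos _), mul_comm]
      exact mul_le_mul_of_nonneg_right (abs_sub_le_of_nonneg_of_le h4 h3 h5 h2) (hpos 1).le
    | succ K ih =>
      intro x hx
      have hd : ∀ y, HasDerivAt
          (fun y => r (K + 2) * (hypoDensity r (K + 2) y - hypoDensity r (K + 3) y))
          (r (K + 2) * (r (K + 1) * (hypoDensity r (K + 1) y - hypoDensity r (K + 2) y) -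
            r (K + 2) * (hypoDensity r (K + 2) y - hypoDensity r (K + 3) y))) y := fun y =>
        ((hasDerivAt_hypoDensity_succ hpos hr (K + 1) y).sub
          (hasDerivAt_hypoDensity_succ hpos hr (K + 2) y)).const_mul _
      have h0 : r (K + 2) * (hypoDensity r (K + 2) 0 - hypoDensity r (K + 3) 0) = 0 := by
        rw [hypoDensity_zero_right hpos hr, hypoDensity_zero_right hpos hr]; ring
      have hB := (mul_pos (hpos 0) (hpos 1)).le
      exact abs_le.2 ⟨ge_of_hasDerivAt_relaxation (hpos _) hd (by rw [h0]; linarith)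
        (fun y hy => (abs_le.1 (ih y hy)).1) hx, le_of_hasDerivAt_relaxation (hpos _) hd
        (by rw [h0]; exact hB) (fun y hy => (abs_le.1 (ih y hy)).2) hx⟩
  have h := hD K x hx
  rw [abs_mul, abs_of_pos (hpos (K + 1))] at h
  rwa [le_div_iff₀ (hpos _), abs_sub_comm, mul_comm]

lemma cexp_mul_hypoDensity (K : ℕ) (u : ℂ) (x : ℝ) :
    Complex.exp (-u * x) * (hypoDensity r K x : ℂ) = ∑ k ∈ Finset.range K,
      (r k * hypoCoeff r K k : ℂ) * Complex.exp (-(u + r k) * x) := by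
  rw [hypoDensity, Complex.ofReal_sum, Finset.mul_sum]
  refine Finset.sum_congr rfl fun k _ => ?_
  push_cast
  rw [show (-(u + r k) * x : ℂ) = -u * x + -(r k * x) by ring, Complex.exp_add]
  ring

lemma integral_cexp_mul_hypoDensity (hpos : ∀ k, 0 < r k) (hr : StrictMono r) (K : ℕ) {u : ℂ}
    (hu : -r 0 < u.re) :
    ∫ x in Ioi (0 : ℝ), Complex.exp (-u * x) * (hypoDensity r (K + 1) x : ℂ) =
      ∏ k ∈ Finset.range (K + 1), (1 + u / (r k : ℂ))⁻¹ := by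
  have hre : ∀ k, (-(u + r k)).re < 0 := fun k => by
    have := hr.monotone (Nat.zero_le k)
    simp only [Complex.neg_re, Complex.add_re, Complex.ofReal_re]; linarith
  have hne : ∀ k, (r k : ℂ) ≠ 0 := fun k => by exact_mod_cast (hpos k).ne'
  have hur : ∀ k, u + r k ≠ 0 := fun k h => by have := hre k; simp [h] at this
  simp only [cexp_mul_hypoDensity]
  rw [integral_finsetSum]
  · have h := sum_prod_erase_partialFraction (K := K) (fun k => (r k : ℂ))
      (Complex.ofReal_injective.comp hr.injective) hne u (fun k h => hur k (by
        have := hne k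
        have h' : (1 + u / (r k : ℂ)) * r k = 0 := by rw [h, zero_mul]
        rw [← h']; field_simp; ring))
    rw [← h]
    refine Finset.sum_congr rfl fun k _ => ?_
    rw [integral_const_mul, integral_exp_mul_complex_Ioi (hre k), hypoCoeff]
    push_cast
    have h1 := hne k
    have h2 := hur k
    have h3 : (r k : ℂ) + u ≠ 0 := by rwa [add_comm]
    have e : (1 + u / (r k : ℂ))⁻¹ = r k / (u + r k) := by field_simp; ring
    rw [e]
    simp only [mul_zero, Complex.exp_zero]
    rw [neg_div_neg_eq]
    ring
  · intro k _
    exact (integrableOn_exp_mul_complex_Ioi (hre k) 0).const_mul _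

end Hypoexponential

/-! ### Mixtures of hypoexponential densities -/

instance PNat.instMeasurableSpaceTop : MeasurableSpace ℕ+ := ⊤

instance PNat.instDiscreteMeasurableSpace : DiscreteMeasurableSpace ℕ+ := ⟨fun _ => trivial⟩

/-- One plus the sum of the first `k` jumps. -/
def jumpLevel (s : ℕ → ℕ+) (k : ℕ) : ℕ := (∑ j ∈ Finset.range k, (s j : ℕ)) + 1

/-- The rate `c * level ^ p` of the holding time before the jump `s k`. -/
noncomputable def jumpRate (c p : ℝ) (s : ℕ → ℕ+) (k : ℕ) : ℝ := c * (jumpLevel s k : ℝ) ^ p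

section Mixture

variable {c p : ℝ}

lemma succ_le_jumpLevel (s : ℕ → ℕ+) (k : ℕ) : k + 1 ≤ jumpLevel s k := by
  have h : ∑ j ∈ Finset.range k, 1 ≤ ∑ j ∈ Finset.range k, (s j : ℕ) :=
    Finset.sum_le_sum fun j _ => (s j).pos
  simp only [Finset.sum_const, Finset.card_range, smul_eq_mul, mul_one] at h
  rw [jumpLevel]; omega

lemma jumpLevel_strictMono (s : ℕ → ℕ+) : StrictMono (jumpLevel s) :=
  strictMono_nat_of_lt_succ fun k => by
    rw [jumpLevel, jumpLevel, Finset.sum_range_succ]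
    have := (s k).pos
    omega

lemma jumpLevel_pos (s : ℕ → ℕ+) (k : ℕ) : (0 : ℝ) < jumpLevel s k := by
  exact_mod_cast (Nat.succ_pos k).trans_le (succ_le_jumpLevel s k)

lemma jumpRate_zero (s : ℕ → ℕ+) : jumpRate c p s 0 = c := by simp [jumpRate, jumpLevel]

lemma jumpRate_pos (hc : 0 < c) (s : ℕ → ℕ+) (k : ℕ) : 0 < jumpRate c p s k :=
  mul_pos hc (Real.rpow_pos_of_pos (jumpLevel_pos s k) _)

lemma jumpRate_strictMono (hc : 0 < c) (hp : 0 < p) (s : ℕ → ℕ+) :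
    StrictMono (jumpRate c p s) := fun _ _ h =>
  mul_lt_mul_of_pos_left (Real.rpow_lt_rpow (jumpLevel_pos s _).le
    (by exact_mod_cast jumpLevel_strictMono s h) hp) hc

lemma le_jumpRate (hc : 0 < c) (hp : 0 < p) (s : ℕ → ℕ+) (k : ℕ) :
    c * ((k + 1 : ℕ) : ℝ) ^ p ≤ jumpRate c p s k :=
  mul_le_mul_of_nonneg_left (Real.rpow_le_rpow (Nat.cast_nonneg _)
    (by exact_mod_cast succ_le_jumpLevel s k) hp.le) hc.le

lemma measurable_jumpRate (k : ℕ) : Measurable fun s => jumpRate c p s k := by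
  have h : ∀ j, Measurable fun s : ℕ → ℕ+ => ((s j : ℕ) : ℝ) := fun j =>
    (Measurable.of_discrete (f := fun z : ℕ+ => ((z : ℕ) : ℝ))).comp (measurable_pi_apply j)
  unfold jumpRate jumpLevel
  push_cast
  exact (((Finset.measurable_fun_sum _ fun j _ => h j).add_const 1).pow_const p).const_mul c

lemma measurable_hypoDensity_jumpRate (K : ℕ) :
    Measurable fun y : ℝ × (ℕ → ℕ+) => hypoDensity (jumpRate c p y.2) K y.1 := by
  have h := fun k => (measurable_jumpRate (c := c) (p := p) k).comp
    (measurable_snd : Measurable fun y : ℝ × (ℕ → ℕ+) => y.2)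
  simp only [Function.comp_def] at h
  unfold hypoDensity hypoCoeff
  fun_prop

lemma summable_succ_rpow_inv (hp : 1 < p) : Summable fun k : ℕ => (((k + 1 : ℕ) : ℝ) ^ p)⁻¹ :=
  (summable_nat_add_iff 1).2 (Real.summable_nat_rpow_inv.2 hp)

/-- The constant is uniform in the jumps because the `k`-th level is at least `k + 1` whatever they
are; the product of costs is then controlled by `∑ (k + 1)⁻ᵖ`. This is the dominating function for
every later limit of densities. -/
lemma exists_hypoDensity_jumpRate_le (hc : 0 < c) (hp : 1 < p) {γ : ℝ} (hγ : 0 ≤ γ)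
    (hγc : γ < c) : ∃ C, ∀ (s : ℕ → ℕ+) (K : ℕ) (x : ℝ), 0 ≤ x →
      hypoDensity (jumpRate c p s) K x ≤ C * Real.exp (-(γ * x)) := by
  have hp0 : 0 < p := by linarith
  set y₀ := γ / c with hy₀
  have hy1 : y₀ < 1 := (div_lt_one hc).2 hγc
  have hy0 : 0 ≤ y₀ := div_nonneg hγ hc.le
  set S := ∑' k : ℕ, (((k + 1 : ℕ) : ℝ) ^ p)⁻¹
  refine ⟨c * Real.exp (y₀ / (1 - y₀) * S), fun s K x hx => ?_⟩
  cases K with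
  | zero => simp only [hypoDensity, Finset.range_zero, Finset.sum_empty]; positivity
  | succ K =>
  have hpos := jumpRate_pos (p := p) hc s
  have hr := jumpRate_strictMono hc hp0 s
  have h := exp_mul_hypoDensity_le hpos hr (c := γ) (by rwa [jumpRate_zero]) K hx
  rw [Real.exp_neg, ← div_eq_mul_inv, le_div_iff₀ (Real.exp_pos _), mul_comm]
  refine h.trans ?_
  rw [jumpRate_zero]
  refine mul_le_mul_of_nonneg_left ?_ hc.le
  have hfac : ∀ j, γ / jumpRate c p s (j + 1) ≤ y₀ * (((j + 1 : ℕ) : ℝ) ^ p)⁻¹ := by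
    intro j
    have h1 : c * ((j + 1 : ℕ) : ℝ) ^ p ≤ jumpRate c p s (j + 1) :=
      (le_jumpRate hc hp0 s j).trans (hr.monotone (Nat.le_succ j))
    rw [hy₀, ← div_eq_mul_inv, ← div_mul_eq_div_div]
    exact div_le_div_of_nonneg_left hγ (by positivity) h1
  have hinv : ∀ j, (((j + 1 : ℕ) : ℝ) ^ p)⁻¹ ≤ 1 := fun j =>
    inv_le_one_of_one_le₀ (Real.one_le_rpow (by push_cast; linarith [j.cast_nonneg (α := ℝ)]) hp0.le)
  calc ∏ j ∈ Finset.range K, (1 - γ / jumpRate c p s (j + 1))⁻¹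
      ≤ ∏ j ∈ Finset.range K, Real.exp (y₀ / (1 - y₀) * (((j + 1 : ℕ) : ℝ) ^ p)⁻¹) := by
        have hy : ∀ j, γ / jumpRate c p s (j + 1) ≤ y₀ := fun j =>
          (hfac j).trans (mul_le_of_le_one_right hy0 (hinv j))
        refine Finset.prod_le_prod (fun j _ => inv_nonneg.2 (by linarith [hy j])) fun j _ => ?_
        set y := γ / jumpRate c p s (j + 1)
        have h1 : 0 < 1 - y := by linarith [hy j]
        have hyn : 0 ≤ y := div_nonneg hγ (hpos _).le
        -- Puts the factor in the form `1 + t ≤ exp t`, with `t` linear in `(j + 1)⁻ᵖ` once `1 - y`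
        -- is bounded below by `1 - y₀`.
        have h2 : (1 - y)⁻¹ = y / (1 - y) + 1 := by field_simp; ring
        have h3 : y / (1 - y) ≤ y / (1 - y₀) :=
          div_le_div_of_nonneg_left hyn (by linarith) (by linarith [hy j])
        have h4 : y / (1 - y₀) ≤ y₀ / (1 - y₀) * (((j + 1 : ℕ) : ℝ) ^ p)⁻¹ := by
          rw [div_mul_eq_mul_div]
          exact div_le_div_of_nonneg_right (hfac j) (by linarith)
        rw [h2]
        exact (Real.add_one_le_exp _).trans (Real.exp_le_exp.2 (h3.trans h4))
    _ = Real.exp (y₀ / (1 - y₀) * ∑ j ∈ Finset.range K, (((j + 1 : ℕ) : ℝ) ^ p)⁻¹) := by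
        rw [← Real.exp_sum, Finset.mul_sum]
    _ ≤ Real.exp (y₀ / (1 - y₀) * S) := by
        refine Real.exp_le_exp.2 (mul_le_mul_of_nonneg_left ?_ (div_nonneg hy0 (by linarith)))
        exact (summable_succ_rpow_inv hp).sum_le_tsum _ fun j _ => by positivity

lemma exists_tendsto_hypoDensity_jumpRate (hc : 0 < c) (hp : 1 < p) (s : ℕ → ℕ+) {x : ℝ}
    (hx : 0 ≤ x) : ∃ l, Tendsto (fun K => hypoDensity (jumpRate c p s) K x) atTop (𝓝 l) := by
  have hp0 : 0 < p := by linarith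
  have hpos := jumpRate_pos (p := p) hc s
  have hr := jumpRate_strictMono hc hp0 s
  have hS : Summable fun K : ℕ => jumpRate c p s 0 * jumpRate c p s 1 / c *
      (((K + 1 + 1 : ℕ) : ℝ) ^ p)⁻¹ :=
    ((summable_nat_add_iff 1).2 (summable_succ_rpow_inv hp)).mul_left _
  have hC : CauchySeq fun K => hypoDensity (jumpRate c p s) (K + 1) x := by
    refine cauchySeq_of_dist_le_of_summable _ (fun K => ?_) hS
    rw [dist_comm, Real.dist_eq]
    refine (abs_hypoDensity_succ_sub_le hpos hr K hx).trans ?_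
    rw [← div_eq_mul_inv, ← div_mul_eq_div_div]
    exact div_le_div_of_nonneg_left (mul_pos (hpos 0) (hpos 1)).le (by positivity)
      (le_jumpRate hc hp0 s _)
  obtain ⟨l, hl⟩ := cauchySeq_tendsto_of_complete hC
  exact ⟨l, (tendsto_add_atTop_iff_nat 1).1 hl⟩

/-- Dominated convergence, once over the jumps at fixed `x` and once over `x`, followed by Fubini.
Nothing about `ν` matters, since the bounds are uniform in the jump sequence. -/
theorem exists_mixtureDensity (ν : Measure (ℕ → ℕ+)) [IsProbabilityMeasure ν] (hc : 0 < c)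
    (hp : 1 < p) : ∃ ψ : ℝ → ℝ, Measurable ψ ∧ (∀ x, 0 ≤ ψ x) ∧
      (∀ x, 0 < x → Tendsto (fun K => ∫ s, hypoDensity (jumpRate c p s) K x ∂ν) atTop (𝓝 (ψ x))) ∧
      ∀ u : ℂ, -c < u.re →
        IntegrableOn (fun x : ℝ => Complex.exp (-u * x) * (ψ x : ℂ)) (Ioi 0) ∧
        Tendsto (fun K => ∫ s, ∏ k ∈ Finset.range K, (1 + u / (jumpRate c p s k : ℂ))⁻¹ ∂ν) atTop
          (𝓝 (∫ x in Ioi (0 : ℝ), Complex.exp (-u * x) * (ψ x : ℂ))) := by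
  have hp0 : 0 < p := by linarith
  have hpos := fun s => jumpRate_pos (p := p) hc s
  have hr := fun s => jumpRate_strictMono hc hp0 s
  have hmeas := measurable_hypoDensity_jumpRate (c := c) (p := p)
  set f : ℕ → ℝ → ℝ := fun K x => ∫ s, hypoDensity (jumpRate c p s) K x ∂ν with hf
  have hfm : ∀ K, Measurable (f K) := fun K =>
    ((hmeas K).stronglyMeasurable.integral_prod_right (ν := ν)).measurable
  have hms : ∀ K x, AEStronglyMeasurable (fun s => hypoDensity (jumpRate c p s) K x) ν :=
    fun K x => ((hmeas K).comp measurable_prodMk_left).aestronglyMeasurable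
  have hf0 : ∀ K x, 0 ≤ x → 0 ≤ f K x := fun K x hx =>
    integral_nonneg fun s => hypoDensity_nonneg (hpos s) (hr s) K hx
  -- Cutting off to `(0, ∞)` makes the limit exist at every real `x`, so that `ψ` is globally
  -- measurable and nonnegative.
  have hlim : ∀ x, ∃ l, Tendsto (fun K => (Ioi (0 : ℝ)).indicator (f K) x) atTop (𝓝 l) := by
    intro x
    by_cases hx : x ∈ Ioi (0 : ℝ)
    · simp only [indicator_of_mem hx]
      have hx' := le_of_lt (mem_Ioi.1 hx)
      choose l hl using fun s => exists_tendsto_hypoDensity_jumpRate hc hp s hx'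
      obtain ⟨C, hC⟩ := exists_hypoDensity_jumpRate_le hc hp le_rfl hc
      refine ⟨∫ s, l s ∂ν, tendsto_integral_of_dominated_convergence
        (fun _ => C * Real.exp (-(0 * x))) (fun K => hms K x) (integrable_const _)
        (fun K => ae_of_all _ fun s => ?_) (ae_of_all _ hl)⟩
      rw [Real.norm_of_nonneg (hypoDensity_nonneg (hpos s) (hr s) K hx')]
      exact hC s K x hx'
    · simp only [indicator_of_notMem hx]
      exact ⟨0, tendsto_const_nhds⟩
  choose ψ hψ using hlim
  have hψ' : ∀ x, 0 < x → Tendsto (fun K => f K x) atTop (𝓝 (ψ x)) := fun x hx => by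
    simpa only [indicator_of_mem (mem_Ioi.2 hx)] using hψ x
  refine ⟨ψ, measurable_of_tendsto_metrizable (fun K => (hfm K).indicator measurableSet_Ioi)
    (tendsto_pi_nhds.2 hψ), fun x => ge_of_tendsto' (hψ x) fun K =>
      indicator_nonneg (fun y hy => hf0 K y (le_of_lt hy)) x, hψ', fun u hu => ?_⟩
  -- A decay rate `γ` strictly between `max 0 (-Re u)` and `c` makes `exp (-(γ + Re u) x)` an
  -- integrable majorant.
  obtain ⟨γ, hγ1, hγc⟩ := exists_between (max_lt hc (neg_lt.1 hu))
  have hγ0 : 0 ≤ γ := (le_max_left _ _).trans hγ1.le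
  have hγu : -u.re < γ := (le_max_right _ _).trans_lt hγ1
  obtain ⟨C, hC⟩ := exists_hypoDensity_jumpRate_le hc hp hγ0 hγc
  have hnorm : ∀ (x y : ℝ), 0 ≤ y → y ≤ C * Real.exp (-(γ * x)) →
      ‖Complex.exp (-u * x) * (y : ℂ)‖ ≤ C * Real.exp (-(γ + u.re) * x) := by
    intro x y hy0 hy
    rw [norm_mul, Complex.norm_exp, Complex.norm_of_nonneg hy0]
    simp only [Complex.mul_re, Complex.neg_re, Complex.ofReal_re, Complex.ofReal_im, mul_zero,
      sub_zero]
    calc Real.exp (-u.re * x) * y ≤ Real.exp (-u.re * x) * (C * Real.exp (-(γ * x))) := by gcongr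
      _ = _ := by rw [mul_left_comm, ← Real.exp_add]; ring_nf
  have hbi : IntegrableOn (fun x : ℝ => C * Real.exp (-(γ + u.re) * x)) (Ioi 0) :=
    (integrableOn_exp_mul_Ioi (by linarith) 0).const_mul C
  have hfC : ∀ K x, 0 ≤ x → f K x ≤ C * Real.exp (-(γ * x)) := by
    intro K x hx
    have := integral_mono_of_nonneg (μ := ν)
      (ae_of_all _ fun s => hypoDensity_nonneg (hpos s) (hr s) K hx)
      (integrable_const (C * Real.exp (-(γ * x)))) (ae_of_all _ fun s => hC s K x hx)
    simpa using this
  have hexpm : Measurable fun x : ℝ => Complex.exp (-u * x) := by fun_prop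
  refine ⟨?_, ?_⟩
  · refine Integrable.mono' hbi ?_ ?_
    · exact (hexpm.mul (Complex.measurable_ofReal.comp (measurable_of_tendsto_metrizable
        (fun K => (hfm K).indicator measurableSet_Ioi)
        (tendsto_pi_nhds.2 hψ)))).aestronglyMeasurable
    · refine (ae_restrict_iff' measurableSet_Ioi).2 (ae_of_all _ fun x hx => ?_)
      have hx' : 0 < x := hx
      exact hnorm x _ (ge_of_tendsto' (hψ' x hx) fun K => hf0 K x hx'.le)
        (le_of_tendsto' (hψ' x hx) fun K => hfC K x hx'.le)
  · have hdom : Tendsto (fun K => ∫ x in Ioi (0 : ℝ), Complex.exp (-u * x) * (f K x : ℂ)) atTop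
        (𝓝 (∫ x in Ioi (0 : ℝ), Complex.exp (-u * x) * (ψ x : ℂ))) := by
      refine tendsto_integral_of_dominated_convergence _ (fun K =>
        (hexpm.mul (Complex.measurable_ofReal.comp (hfm K))).aestronglyMeasurable) hbi
        (fun K => ?_) ?_
      · refine (ae_restrict_iff' measurableSet_Ioi).2 (ae_of_all _ fun x hx => ?_)
        exact hnorm x _ (hf0 K x (le_of_lt hx)) (hfC K x (le_of_lt hx))
      · refine (ae_restrict_iff' measurableSet_Ioi).2 (ae_of_all _ fun x hx => ?_)
        exact ((Complex.continuous_ofReal.tendsto _).comp (hψ' x hx)).const_mul _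
    refine (hdom.congr' ?_)
    -- At `K = 0` the density is zero while the empty product is `1`, so the transform identity
    -- needs `K ≥ 1`.
    filter_upwards [eventually_ge_atTop 1] with K hK
    obtain ⟨K, rfl⟩ := Nat.exists_eq_add_of_le' hK
    have hswap := integral_integral_swap (μ := volume.restrict (Ioi (0 : ℝ))) (ν := ν)
      (f := fun x s => Complex.exp (-u * x) * (hypoDensity (jumpRate c p s) (K + 1) x : ℂ)) (by
        refine Integrable.mono' (hbi.integrable.comp_fst ν) ?_ ?_
        · exact ((hexpm.comp measurable_fst).mul
            (Complex.measurable_ofReal.comp (hmeas (K + 1)))).aestronglyMeasurable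
        · have : ∀ᵐ y ∂((volume.restrict (Ioi (0 : ℝ))).prod ν), y.1 ∈ Ioi (0 : ℝ) :=
            Measure.quasiMeasurePreserving_fst.ae (ae_restrict_mem measurableSet_Ioi)
          filter_upwards [this] with y hy
          exact hnorm y.1 _ (hypoDensity_nonneg (hpos _) (hr _) _ (le_of_lt hy))
            (hC _ _ _ (le_of_lt hy)))
    calc _ = ∫ x in Ioi (0 : ℝ), ∫ s, Complex.exp (-u * x) *
          (hypoDensity (jumpRate c p s) (K + 1) x : ℂ) ∂ν := by
          refine integral_congr_ae (ae_of_all _ fun x => ?_)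
          simp only [hf]
          rw [integral_const_mul, integral_complex_ofReal]
      _ = _ := by
          rw [hswap]
          refine integral_congr_ae (ae_of_all _ fun s => ?_)
          exact integral_cexp_mul_hypoDensity (hpos s) (hr s) K (by rwa [jumpRate_zero])

end Mixture

/-! ### The law of the positive jumps and sums over jump sizes -/

/-- The law `μ` conditioned to be positive. -/
noncomputable def jumpLaw (μ : Measure ℕ) : Measure ℕ+ :=
  (μ {0}ᶜ)⁻¹ • μ.comap (fun z : ℕ+ => (z : ℕ))

section JumpLaw

variable {μ : Measure ℕ}

lemma measurableEmbedding_pnat_val : MeasurableEmbedding (fun z : ℕ+ => (z : ℕ)) :=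
  ⟨PNat.coe_injective, .of_discrete, fun _ _ => .of_discrete⟩

lemma range_pnat_val : range (fun z : ℕ+ => (z : ℕ)) = {0}ᶜ := by
  ext k
  simp only [mem_range, mem_compl_iff, mem_singleton_iff]
  exact ⟨fun ⟨z, hz⟩ => hz ▸ z.ne_zero, fun h => ⟨⟨k, Nat.pos_of_ne_zero h⟩, rfl⟩⟩

lemma isProbabilityMeasure_jumpLaw [IsFiniteMeasure μ] (h : μ {0}ᶜ ≠ 0) :
    IsProbabilityMeasure (jumpLaw μ) := by
  refine ⟨?_⟩
  rw [jumpLaw, Measure.smul_apply, measurableEmbedding_pnat_val.comap_apply, image_univ,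
    range_pnat_val, smul_eq_mul, ENNReal.inv_mul_cancel h (measure_ne_top _ _)]

lemma jumpLaw_real_singleton (z : ℕ+) :
    (jumpLaw μ).real {z} = (μ.real {0}ᶜ)⁻¹ * μ.real {(z : ℕ)} := by
  rw [measureReal_def, jumpLaw, Measure.smul_apply, measurableEmbedding_pnat_val.comap_apply,
    image_singleton, smul_eq_mul, ENNReal.toReal_mul, ENNReal.toReal_inv]
  rfl

lemma integral_jumpLaw (f : ℕ → ℂ) :
    ∫ z : ℕ+, f z ∂(jumpLaw μ) = ((μ.real {0}ᶜ)⁻¹ : ℝ) • ∫ k in {0}ᶜ, f k ∂μ := by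
  rw [jumpLaw, integral_smul_measure, ← measurableEmbedding_pnat_val.integral_map (g := f),
    measurableEmbedding_pnat_val.map_comap, range_pnat_val, ENNReal.toReal_inv]
  rfl

/-- The first `K` coordinates have a product law on a countable space, whose atoms are the weights
of the series divided by `μ.real {0}ᶜ ^ K`. Boundedness of `G` alone gives convergence. -/
lemma hasSum_prod_smul_integral_infinitePi {E : Type*} [NormedAddCommGroup E] [NormedSpace ℝ E]
    [CompleteSpace E] [IsFiniteMeasure μ] (h : μ {0}ᶜ ≠ 0) (K : ℕ)
    {G : (Fin K → ℕ+) → E} {B : ℝ} (hG : ∀ z, ‖G z‖ ≤ B) :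
    HasSum (fun z : Fin K → ℕ+ => (∏ k, μ.real {(z k : ℕ)}) • G z)
      (μ.real {0}ᶜ ^ K • ∫ s : ℕ → ℕ+, G (fun i => s i)
        ∂(Measure.infinitePi fun _ => jumpLaw μ)) := by
  have := isProbabilityMeasure_jumpLaw h
  have hmap : (Measure.infinitePi fun _ : ℕ => jumpLaw μ).map (fun s (i : Fin K) => s i) =
      Measure.pi fun _ => jumpLaw μ := by
    have hi : iIndepFun (fun (i : ℕ) (s : ℕ → ℕ+) => s i)
        (Measure.infinitePi fun _ : ℕ => jumpLaw μ) :=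
      iIndepFun_infinitePi (X := fun _ z => z) fun _ => measurable_id
    have h2 := (hi.precomp (g := fun i : Fin K => (i : ℕ)) Fin.val_injective).map_fun_eq_pi_map
      (fun i => (measurable_pi_apply _).aemeasurable)
    refine h2.trans ?_
    congr 1
    funext i
    exact Measure.infinitePi_map_eval (fun _ : ℕ => jumpLaw μ) i
  have hGm : StronglyMeasurable G := .of_discrete
  have hm : Measurable fun (s : ℕ → ℕ+) (i : Fin K) => s i :=
    measurable_pi_lambda _ fun i => measurable_pi_apply _
  have hint : Integrable G (Measure.pi fun _ : Fin K => jumpLaw μ) :=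
    Integrable.of_bound hGm.aestronglyMeasurable B (ae_of_all _ hG)
  have hs : HasSum (fun z => (Measure.pi fun _ : Fin K => jumpLaw μ).real {z} • G z)
      (∫ z, G z ∂(Measure.pi fun _ : Fin K => jumpLaw μ)) := by
    have hint' := hint
    rw [← Measure.sum_smul_dirac (Measure.pi fun _ : Fin K => jumpLaw μ)] at hint'
    have h3 := hasSum_integral_measure hint'
    rw [Measure.sum_smul_dirac] at h3
    simpa only [integral_smul_measure, integral_dirac, measureReal_def] using h3
  rw [← hmap, integral_map hm.aemeasurable hGm.aestronglyMeasurable, hmap] at hs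
  have hs' := hs.const_smul (μ.real {0}ᶜ ^ K)
  convert hs' using 2 with z
  rw [smul_smul]
  congr 1
  rw [measureReal_def (Measure.pi _), Measure.pi_singleton, ENNReal.toReal_prod]
  simp only [← measureReal_def, jumpLaw_real_singleton]
  have h0 : μ.real {0}ᶜ ≠ 0 := by
    rw [measureReal_def]; exact ENNReal.toReal_ne_zero.2 ⟨h, measure_ne_top _ _⟩
  rw [Finset.prod_mul_distrib, Finset.prod_const, Finset.card_univ, Fintype.card_fin, ← mul_assoc,
    ← mul_pow, mul_inv_cancel₀ h0, one_pow, one_mul]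

lemma level_eq_jumpLevel {K : ℕ} (s : ℕ → ℕ+) (k : Fin K) :
    level (fun i : Fin K => s i) k = jumpLevel s k := by
  have h : ∑ j ∈ Finset.Iio k, ((s j : ℕ) : ℝ) = ∑ j ∈ Finset.range k, ((s j : ℕ) : ℝ) := by
    rw [← Nat.Iio_eq_range, ← Fin.map_valEmbedding_Iio, Finset.sum_map]
    rfl
  rw [level, jumpLevel]
  push_cast
  rw [← h]

lemma exists_extension {K : ℕ} (z : Fin K → ℕ+) : ∃ s : ℕ → ℕ+, (fun i : Fin K => s i) = z :=
  ⟨fun j => if h : j < K then z ⟨j, h⟩ else 1, by ext i; simp⟩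

lemma one_le_level {K : ℕ} (z : Fin K → ℕ+) (k : Fin K) : 1 ≤ level z k := by
  rw [level, le_add_iff_nonneg_left]
  exact Finset.sum_nonneg fun j _ => Nat.cast_nonneg _

lemma hasSum_laplaceTerm [IsFiniteMeasure μ] (h : μ {0}ᶜ ≠ 0) {lam : ℝ≥0} (hlam : 0 < lam)
    {p : ℝ} (hp : 0 < p) {u : ℂ} (hu : -(lam * μ.real {0}ᶜ) < u.re) (K : ℕ) :
    HasSum (fun z : Fin K → ℕ+ => laplaceTerm lam (fun k => μ.real {k}) (μ.real {0}ᶜ) p u z)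
      (((μ.real {0}ᶜ ^ K : ℝ) : ℂ) * ∫ s : ℕ → ℕ+, ∏ k ∈ Finset.range K,
        (1 + u / (jumpRate (lam * μ.real {0}ᶜ) p s k : ℂ))⁻¹
        ∂(Measure.infinitePi fun _ => jumpLaw μ)) := by
  have hr : 0 < μ.real {0}ᶜ := ENNReal.toReal_pos h (measure_ne_top _ _)
  have hc : 0 < lam * μ.real {0}ᶜ := mul_pos (by exact_mod_cast hlam) hr
  set c := lam * μ.real {0}ᶜ with hcdef
  -- A lower bound for the real part of every factor `1 + u / (c * level ^ p)`: levels are at least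
  -- `1`, so a negative `Re u` hurts most at level `1`.
  set m := min 1 (1 + u.re / c)
  have hm : 0 < m := by
    refine lt_min one_pos ?_
    have : -1 < u.re / c := by rw [lt_div_iff₀ hc]; linarith
    linarith
  have hfac : ∀ (z : Fin K → ℕ+) k, ‖(1 + u / ((c * level z k ^ p : ℝ) : ℂ))⁻¹‖ ≤ m⁻¹ := by
    intro z k
    rw [norm_inv]
    refine inv_anti₀ hm (le_trans ?_ (Complex.re_le_norm _))
    rw [Complex.add_re, Complex.div_ofReal_re, Complex.one_re]
    have hl : 1 ≤ level z k ^ p := Real.one_le_rpow (one_le_level z k) hp.le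
    rcases le_total 0 u.re with h0 | h0
    · refine (min_le_left _ _).trans ?_
      have : 0 ≤ u.re / (c * level z k ^ p) := by positivity
      linarith
    · refine (min_le_right _ _).trans ?_
      have h1 : -u.re / (c * level z k ^ p) ≤ -u.re / c :=
        div_le_div_of_nonneg_left (by linarith) hc (le_mul_of_one_le_right hc.le hl)
      rw [neg_div, neg_div] at h1
      linarith
  have hs := hasSum_prod_smul_integral_infinitePi h K
    (G := fun z => ∏ k, (1 + u / ((c * level z k ^ p : ℝ) : ℂ))⁻¹) (B := m⁻¹ ^ K) (fun z => by
      rw [norm_prod]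
      refine (Finset.prod_le_prod (fun _ _ => norm_nonneg _) fun k _ => hfac z k).trans ?_
      simp)
  simp only [Complex.real_smul] at hs
  have e : ∀ s : ℕ → ℕ+, ∏ k : Fin K,
      (1 + u / ((c * level (fun i : Fin K => s i) k ^ p : ℝ) : ℂ))⁻¹ =
      ∏ k ∈ Finset.range K, (1 + u / (jumpRate c p s k : ℂ))⁻¹ := fun s => by
    rw [← Fin.prod_univ_eq_prod_range fun k => (1 + u / (jumpRate c p s k : ℂ))⁻¹]
    simp only [level_eq_jumpLevel, jumpRate]
  simp only [e] at hs
  exact hs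

/-- The sum over `k₁`, kept whole, is `c⁻¹` times a hypoexponential density and so is bounded
uniformly in the jumps; the bound is not sought for its separate terms. -/
lemma hasSum_densityTerm [IsFiniteMeasure μ] (h : μ {0}ᶜ ≠ 0) {lam : ℝ≥0} (hlam : 0 < lam)
    {p : ℝ} (hp : 1 < p) {x : ℝ} (hx : 0 ≤ x) (K : ℕ) :
    HasSum (fun z : Fin K → ℕ+ => densityTerm lam (fun k => μ.real {k}) (μ.real {0}ᶜ) p x z)
      (μ.real {0}ᶜ ^ K * ((lam * μ.real {0}ᶜ)⁻¹ * ∫ s : ℕ → ℕ+,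
        hypoDensity (jumpRate (lam * μ.real {0}ᶜ) p s) K x
        ∂(Measure.infinitePi fun _ => jumpLaw μ))) := by
  have hr : 0 < μ.real {0}ᶜ := ENNReal.toReal_pos h (measure_ne_top _ _)
  have hc : 0 < lam * μ.real {0}ᶜ := mul_pos (by exact_mod_cast hlam) hr
  set c := lam * μ.real {0}ᶜ with hcdef
  obtain ⟨C, hC⟩ := exists_hypoDensity_jumpRate_le hc hp le_rfl hc
  set G : (Fin K → ℕ+) → ℝ := fun z => ∑ k₁, level z k₁ ^ p *
    Real.exp (-(c * level z k₁ ^ p * x)) *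
    ∏ k₂ ∈ Finset.univ.erase k₁, (1 - (level z k₁ / level z k₂) ^ p)⁻¹ with hG
  have e : ∀ s : ℕ → ℕ+, G (fun i => s i) = c⁻¹ * hypoDensity (jumpRate c p s) K x := by
    intro s
    rw [hypoDensity, ← Fin.sum_univ_eq_sum_range (fun k => jumpRate c p s k *
      Real.exp (-(jumpRate c p s k * x)) * hypoCoeff (jumpRate c p s) K k), Finset.mul_sum, hG]
    refine Finset.sum_congr rfl fun k _ => ?_
    have hcoeff : hypoCoeff (jumpRate c p s) K k = ∏ k₂ ∈ (Finset.univ : Finset (Fin K)).erase k,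
        (1 - (jumpLevel s k / jumpLevel s k₂ : ℝ) ^ p)⁻¹ := by
      have hmap : (Finset.range K).erase (k : ℕ) =
          ((Finset.univ : Finset (Fin K)).erase k).map Fin.valEmbedding := by
        rw [Finset.map_erase, Fin.map_valEmbedding_univ, Nat.Iio_eq_range]
        rfl
      rw [hypoCoeff, hmap, Finset.prod_map]
      refine Finset.prod_congr rfl fun j _ => ?_
      rw [Real.div_rpow (jumpLevel_pos s k).le (jumpLevel_pos s j).le, Fin.valEmbedding_apply,
        jumpRate, jumpRate, mul_div_mul_left _ _ hc.ne']
    simp only [level_eq_jumpLevel]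
    rw [hcoeff, jumpRate, ← mul_assoc, ← mul_assoc, ← mul_assoc, inv_mul_cancel₀ hc.ne', one_mul]
  have hB : ∀ z, ‖G z‖ ≤ c⁻¹ * C := by
    intro z
    obtain ⟨s, rfl⟩ := exists_extension z
    rw [e, norm_mul, Real.norm_of_nonneg (inv_pos.2 hc).le, Real.norm_of_nonneg
      (hypoDensity_nonneg (jumpRate_pos hc s) (jumpRate_strictMono hc (by linarith) s) K hx)]
    refine mul_le_mul_of_nonneg_left ?_ (inv_pos.2 hc).le
    simpa using hC s K x hx
  have hs := hasSum_prod_smul_integral_infinitePi h K hB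
  simp only [e, integral_const_mul, smul_eq_mul] at hs
  exact hs

end JumpLaw

/-! ### Multiplicative functionals of random walks on `ℕ` -/

/-- The transition operator, with step law `μ`, weighted by `g`. -/
noncomputable def walkOp (g : ℕ → ℂ) (μ : Measure ℕ) (h : ℕ → ℂ) (a : ℕ) : ℂ :=
  g a * ∫ k, h (a + k) ∂μ

section Walk

variable {Ω : Type*} [MeasurableSpace Ω] {P : Measure Ω} [IsProbabilityMeasure P]
  {Y : ℕ → Ω → ℕ} {μ : Measure ℕ}

lemma norm_walkOp_le [IsProbabilityMeasure μ] {g h : ℕ → ℂ} {B B' : ℝ} (hg : ∀ a, ‖g a‖ ≤ B)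
    (hh : ∀ a, ‖h a‖ ≤ B') (a : ℕ) : ‖walkOp g μ h a‖ ≤ B * B' := by
  rw [walkOp, norm_mul]
  refine mul_le_mul (hg a) ?_ (norm_nonneg _) ((norm_nonneg _).trans (hg a))
  have := norm_integral_le_of_norm_le_const (μ := μ) (f := fun k => h (a + k)) (C := B')
    (ae_of_all _ fun k => hh _)
  simpa using this

/-- Markov property: integrating out the last step, independent of the earlier ones, replaces `h` by
`walkOp g μ h`. Hence `h` is left general in the induction. -/
theorem integral_prod_walk [IsProbabilityMeasure μ] (hY : ∀ i, Measurable (Y i))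
    (hind : iIndepFun Y P) (hlaw : ∀ i, P.map (Y i) = μ) {g : ℕ → ℂ} {B : ℝ}
    (hg : ∀ a, ‖g a‖ ≤ B) (a M : ℕ) : ∀ {h : ℕ → ℂ} {B' : ℝ}, (∀ a, ‖h a‖ ≤ B') →
    ∫ ω, (∏ i ∈ Finset.range M, g (a + ∑ j ∈ Finset.range i, Y j ω)) *
      h (a + ∑ j ∈ Finset.range M, Y j ω) ∂P = (walkOp g μ)^[M] h a := by
  induction M with
  | zero => intro h B' hh; simp
  | succ M ih =>
    intro h B' hh
    rw [Function.iterate_succ_apply, ← ih (norm_walkOp_le hg hh)]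
    -- Extends the first `M` steps by zero, so partial sums are functions of a finite vector
    -- independent of `Y M`.
    let ext : (Finset.range M → ℕ) → ℕ → ℕ := fun x j =>
      if hj : j ∈ Finset.range M then x ⟨j, hj⟩ else 0
    let X : Ω → Finset.range M → ℕ := fun ω i => Y i ω
    have hext : ∀ ω i, i ≤ M → ∑ j ∈ Finset.range i, ext (X ω) j = ∑ j ∈ Finset.range i, Y j ω :=
      fun ω i hi => Finset.sum_congr rfl fun j hj => by
        have : j < M := (Finset.mem_range.1 hj).trans_le hi
        simp [ext, X, this]
    let F : (Finset.range M → ℕ) → ℕ → ℂ := fun x k =>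
      (∏ i ∈ Finset.range (M + 1), g (a + ∑ j ∈ Finset.range i, ext x j)) *
        h (a + (∑ j ∈ Finset.range M, ext x j + k))
    have hF : ∀ x k, ‖F x k‖ ≤ B ^ (M + 1) * B' := fun x k => by
      rw [norm_mul, norm_prod]
      refine mul_le_mul ?_ (hh _) (norm_nonneg _)
        (pow_nonneg ((norm_nonneg _).trans (hg 0)) _)
      refine (Finset.prod_le_prod (fun _ _ => norm_nonneg _) fun i _ => hg _).trans ?_
      simp
    have hX : Measurable X := measurable_pi_lambda _ fun i => hY i
    have hXY : IndepFun X (Y M) P := by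
      have h1 := hind.indepFun_finset (Finset.range M) {M} (by simp) hY
      exact h1.comp measurable_id
        (measurable_pi_apply (⟨M, Finset.mem_singleton_self M⟩ : ({M} : Finset ℕ)))
    have hmap := (indepFun_iff_map_prod_eq_prod_map_map hX.aemeasurable (hY M).aemeasurable).1 hXY
    rw [hlaw] at hmap
    have : IsProbabilityMeasure (P.map X) := Measure.isProbabilityMeasure_map hX.aemeasurable
    have hFm : StronglyMeasurable (fun y : (Finset.range M → ℕ) × ℕ => F y.1 y.2) := .of_discrete
    have hFint : Integrable (fun y : (Finset.range M → ℕ) × ℕ => F y.1 y.2)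
        ((P.map X).prod μ) :=
      Integrable.of_bound hFm.aestronglyMeasurable _ (ae_of_all _ fun y => hF _ _)
    calc _ = ∫ ω, F (X ω) (Y M ω) ∂P := by
          refine integral_congr_ae (ae_of_all _ fun ω => ?_)
          simp only [F]
          rw [hext ω M le_rfl, Finset.sum_range_succ]
          congr 1
          exact Finset.prod_congr rfl fun i hi => by
            rw [hext ω i (Nat.lt_succ_iff.1 (Finset.mem_range.1 hi))]
      _ = ∫ y, F y.1 y.2 ∂(P.map fun ω => (X ω, Y M ω)) :=
          (integral_map (hX.prodMk (hY M)).aemeasurable hFm.aestronglyMeasurable).symm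
      _ = ∫ ω, ∫ k, F (X ω) k ∂μ ∂P := by
          rw [hmap, integral_prod _ hFint]
          exact integral_map hX.aemeasurable StronglyMeasurable.of_discrete.aestronglyMeasurable
      _ = _ := by
          refine integral_congr_ae (ae_of_all _ fun ω => ?_)
          simp only [F]
          rw [integral_const_mul, Finset.prod_range_succ, hext ω M le_rfl, mul_assoc, walkOp]
          simp only [add_assoc]
          congr 1
          exact Finset.prod_congr rfl fun i hi => by
            rw [hext ω i (Finset.mem_range.1 hi).le]

/-- The expected number of visits of a nondecreasing random walk to a given level is finite. -/
lemma tsum_measure_walk_eq_le [IsProbabilityMeasure μ] (hY : ∀ i, Measurable (Y i))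
    (hind : iIndepFun Y P) (hlaw : ∀ i, P.map (Y i) = μ) (k : ℕ) :
    (∑' i, P {ω | ∑ j ∈ Finset.range i, Y j ω = k}) * μ {0}ᶜ ≤ 1 := by
  have hS : ∀ i, Measurable fun ω => ∑ j ∈ Finset.range i, Y j ω := fun i =>
    Finset.measurable_fun_sum _ fun j _ => hY j
  -- By independence this is the probability of leaving level `k` at step `i`; a nondecreasing walk
  -- leaves it at most once, so these events are disjoint.
  have hprod : ∀ i, P {ω | ∑ j ∈ Finset.range i, Y j ω = k} * μ {0}ᶜ =
      P ({ω | ∑ j ∈ Finset.range i, Y j ω = k} ∩ Y i ⁻¹' {0}ᶜ) := by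
    intro i
    have h1 : IndepFun (fun ω => ∑ j ∈ Finset.range i, Y j ω) (Y i) P := by
      have := hind.indepFun_finsetSum_of_notMem hY (s := Finset.range i) (i := i) (by simp)
      convert this using 1
      ext ω; simp
    have h2 := h1.measure_inter_preimage_eq_mul {k} {0}ᶜ .of_discrete .of_discrete
    rw [← hlaw i, Measure.map_apply (hY i) .of_discrete]
    exact h2.symm
  rw [← ENNReal.tsum_mul_right]
  simp only [hprod]
  rw [← measure_iUnion]
  · exact prob_le_one
  · intro i i' hii
    have key : ∀ i i', i < i' → Disjoint
        ({ω | ∑ j ∈ Finset.range i, Y j ω = k} ∩ Y i ⁻¹' {0}ᶜ)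
        ({ω | ∑ j ∈ Finset.range i', Y j ω = k} ∩ Y i' ⁻¹' {0}ᶜ) := by
      intro i i' hlt
      rw [Set.disjoint_left]
      rintro ω ⟨h1, h2⟩ ⟨h3, -⟩
      have h4 : ∑ j ∈ Finset.range (i + 1), Y j ω ≤ ∑ j ∈ Finset.range i', Y j ω :=
        Finset.sum_le_sum_of_subset (Finset.range_mono hlt)
      rw [Finset.sum_range_succ] at h4
      simp only [mem_ofPred_eq, mem_preimage, mem_compl_iff, mem_singleton_iff] at h1 h2 h3
      omega
    rcases lt_or_gt_of_ne hii with h | h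
    · exact key i i' h
    · exact (key i' i h).symm
  · intro i
    exact (hS i (measurableSet_singleton k)).inter ((hY i) .of_discrete)

/-- Its expectation is `∑ f k` times the expected number of visits to `k`, which is at most `(μ
{0}ᶜ)⁻¹`. -/
lemma ae_summable_comp_walk [IsProbabilityMeasure μ] (hY : ∀ i, Measurable (Y i))
    (hind : iIndepFun Y P) (hlaw : ∀ i, P.map (Y i) = μ) (hμ : μ {0}ᶜ ≠ 0) {f : ℕ → ℝ}
    (hf0 : ∀ k, 0 ≤ f k) (hf : Summable f) :
    ∀ᵐ ω ∂P, Summable fun i => f (∑ j ∈ Finset.range i, Y j ω) := by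
  have hS : ∀ i, Measurable fun ω => ∑ j ∈ Finset.range i, Y j ω := fun i =>
    Finset.measurable_fun_sum _ fun j _ => hY j
  have hfm : ∀ i, AEMeasurable (fun ω => ENNReal.ofReal (f (∑ j ∈ Finset.range i, Y j ω))) P :=
    fun i => ((Measurable.of_discrete (f := fun k => ENNReal.ofReal (f k))).comp
      (hS i)).aemeasurable
  have hfin : ∫⁻ ω, ∑' i, ENNReal.ofReal (f (∑ j ∈ Finset.range i, Y j ω)) ∂P ≠ ∞ := by
    rw [lintegral_tsum hfm]
    have h1 : ∀ i, ∫⁻ ω, ENNReal.ofReal (f (∑ j ∈ Finset.range i, Y j ω)) ∂P =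
        ∑' k, ENNReal.ofReal (f k) * P {ω | ∑ j ∈ Finset.range i, Y j ω = k} := by
      intro i
      rw [← lintegral_map (f := fun k => ENNReal.ofReal (f k)) .of_discrete (hS i),
        lintegral_countable']
      refine tsum_congr fun k => ?_
      rw [Measure.map_apply (hS i) .of_discrete]
      rfl
    simp only [h1]
    rw [ENNReal.tsum_comm]
    simp only [ENNReal.tsum_mul_left]
    refine ne_top_of_le_ne_top ?_ (ENNReal.tsum_le_tsum fun k => mul_le_mul_right
      (ENNReal.le_div_iff_mul_le (.inl hμ) (.inl (measure_ne_top _ _)) |>.2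
        (tsum_measure_walk_eq_le hY hind hlaw k)) _)
    rw [ENNReal.tsum_mul_right]
    refine ENNReal.mul_ne_top ?_ (ENNReal.div_ne_top (by simp) hμ)
    rw [← ENNReal.ofReal_tsum_of_nonneg hf0 hf]
    exact ENNReal.ofReal_ne_top
  have hae := ae_lt_top' (AEMeasurable.tsum hfm) hfin
  filter_upwards [hae] with ω hω
  have := ENNReal.summable_toReal hω.ne
  simpa only [ENNReal.toReal_ofReal (hf0 _)] using this

end Walk

/-! ### Compositions of independent Poisson processes -/

/-- The law of `X T`, for a Poisson process `X` of intensity `lam` and an independent time `T` of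
law `μ`. -/
noncomputable def poissonBind (lam : ℝ≥0) (μ : Measure ℕ) : Measure ℕ :=
  μ.bind fun k : ℕ => poissonMeasure (lam * k)

/-- The law of the `m`-fold iterated Poisson process at time `1`. -/
noncomputable def iteratedLaw (lam : ℝ≥0) : ℕ → Measure ℕ
  | 0 => Measure.dirac 1
  | m + 1 => poissonBind lam (iteratedLaw lam m)

/-- The law of the `(m + 1)`-fold iterated Poisson process at time `δ`. -/
noncomputable def compositeLaw (lam δ : ℝ≥0) : ℕ → Measure ℕ
  | 0 => poissonMeasure (lam * δ)
  | m + 1 => poissonBind lam (compositeLaw lam δ m)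

/-- The process `iteratedProcess N (m + 1)`, as a process with values in `ℕ`. -/
def compositeProcess {Ω : Type*} (N : ℕ → ℝ≥0 → Ω → ℕ) : ℕ → ℝ≥0 → Ω → ℕ
  | 0, t, ω => N 0 t ω
  | m + 1, t, ω => N (m + 1) (compositeProcess N m t ω) ω

section Law

variable {lam : ℝ≥0}

instance (μ : Measure ℕ) [IsProbabilityMeasure μ] : IsProbabilityMeasure (poissonBind lam μ) :=
  isProbabilityMeasure_bind Measurable.of_discrete.aemeasurable
    (ae_of_all _ fun _ => inferInstance)

instance (m : ℕ) : IsProbabilityMeasure (iteratedLaw lam m) := by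
  induction m with
  | zero => rw [iteratedLaw]; infer_instance
  | succ m ih => rw [iteratedLaw]; infer_instance

instance (δ : ℝ≥0) (m : ℕ) : IsProbabilityMeasure (compositeLaw lam δ m) := by
  induction m with
  | zero => rw [compositeLaw]; infer_instance
  | succ m ih => rw [compositeLaw]; infer_instance

lemma lintegral_poissonBind (μ : Measure ℕ) (f : ℕ → ℝ≥0∞) :
    ∫⁻ k, f k ∂(poissonBind lam μ) = ∫⁻ j, ∫⁻ k, f k ∂(poissonMeasure (lam * j)) ∂μ :=
  Measure.lintegral_bind Measurable.of_discrete.aemeasurable Measurable.of_discrete.aemeasurable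

lemma compositeLaw_one (m : ℕ) : compositeLaw lam 1 m = iteratedLaw lam (m + 1) := by
  induction m with
  | zero =>
    rw [compositeLaw, iteratedLaw, iteratedLaw, poissonBind, Measure.dirac_bind .of_discrete]
    simp
  | succ m ih => rw [compositeLaw, ih]; rfl

end Law

section Paths

variable {Ω : Type*} {N : ℕ → ℝ≥0 → Ω → ℕ}

lemma iteratedProcess_succ (m : ℕ) (t : ℝ≥0) (ω : Ω) :
    iteratedProcess N (m + 1) t ω = compositeProcess N m t ω := by
  induction m with
  | zero => rfl
  | succ m ih => rw [iteratedProcess, ih, compositeProcess]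

lemma monotone_compositeProcess {m : ℕ} {ω : Ω} (hN : ∀ i ≤ m, Monotone fun t => N i t ω) :
    Monotone fun t => compositeProcess N m t ω := by
  induction m with
  | zero => exact hN 0 le_rfl
  | succ m ih =>
    intro s t hst
    exact hN (m + 1) le_rfl (Nat.cast_le.2 (ih (fun i hi => hN i (hi.trans m.le_succ)) hst))

lemma compositeProcess_zero {m : ℕ} {ω : Ω} (hN : ∀ i ≤ m, N i 0 ω = 0) :
    compositeProcess N m 0 ω = 0 := by
  induction m with
  | zero => exact hN 0 le_rfl
  | succ m ih =>
    rw [compositeProcess, ih fun i hi => hN i (hi.trans m.le_succ), Nat.cast_zero]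
    exact hN _ le_rfl

end Paths

/-! ### Independent increments under composition. -/

section Composite

variable {Ω : Type*} [MeasurableSpace Ω] {P : Measure Ω} {lam : ℝ≥0} {N : ℕ → ℝ≥0 → Ω → ℕ}

/-- Evaluation at a random time is measurable because the inner process takes countably many values.
-/
lemma measurable_compositeProcess {m : ℕ} (hN : ∀ i ≤ m, ∀ t, Measurable (N i t)) (t : ℝ≥0) :
    Measurable (compositeProcess N m t) := by
  induction m with
  | zero => exact hN 0 le_rfl t
  | succ m ih =>
    have h1 : Measurable fun y : ℕ × Ω => N (m + 1) y.1 y.2 :=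
      measurable_from_prod_countable_right fun k => hN (m + 1) le_rfl k
    exact h1.comp ((ih fun i hi => hN i (hi.trans m.le_succ)).prodMk measurable_id)

/-- The increments of `A` are independent with common law `μ`, in terms of expectations of
products. -/
def HasIIDIncrements (A : ℕ → Ω → ℕ) (μ : Measure ℕ) (P : Measure Ω) : Prop :=
  ∀ (M : ℕ) (F : ℕ → ℕ → ℝ≥0∞),
    ∫⁻ ω, ∏ i ∈ Finset.range M, F i (A (i + 1) ω - A i ω) ∂P =
      ∏ i ∈ Finset.range M, ∫⁻ k, F i k ∂μ

lemma IsPoissonProcess.lintegral_prod_increments {X : ℝ≥0 → Ω → ℕ}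
    (hX : IsPoissonProcess X lam P) {t : ℕ → ℝ≥0} (ht : Monotone t) (M : ℕ)
    (F : ℕ → ℕ → ℝ≥0∞) :
    ∫⁻ ω, ∏ i ∈ Finset.range M, F i (X (t (i + 1)) ω - X (t i) ω) ∂P =
      ∏ i ∈ Finset.range M, ∫⁻ k, F i k ∂(poissonMeasure (lam * (t (i + 1) - t i))) := by
  have hF : ∀ i, Measurable (F i) := fun i => .of_discrete
  have hY : ∀ i, Measurable fun ω => X (t (i + 1)) ω - X (t i) ω := fun i =>
    (hX.measurable _).sub (hX.measurable _)
  rw [lintegral_prod_eq_prod_lintegral_of_indepFun (Finset.range M)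
    (fun i ω => F i (X (t (i + 1)) ω - X (t i) ω)) ((hX.indep_increments.nat ht).comp F hF)
    fun i => (hF i).comp (hY i)]
  refine Finset.prod_congr rfl fun i _ => ?_
  rw [← (hX.law_increments _ _ (ht i.le_succ)).map_eq, lintegral_map (hF i) (hY i)]

lemma IsPoissonProcess.hasIIDIncrements {X : ℝ≥0 → Ω → ℕ} (hX : IsPoissonProcess X lam P)
    (δ : ℝ≥0) : HasIIDIncrements (fun j => X (j * δ)) (poissonMeasure (lam * δ)) P := by
  intro M F
  have h := hX.lintegral_prod_increments (t := fun j : ℕ => (j : ℝ≥0) * δ)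
    (fun i j hij => by dsimp only; gcongr) M F
  refine h.trans (Finset.prod_congr rfl fun i _ => ?_)
  congr 3
  push_cast
  rw [add_mul, one_mul, add_tsub_cancel_left]

/-- Condition on `A`: the increments of `X` along `A` are independent Poisson, so the conditional
expectation is again a product of functions of the increments of `A`. The product form of
`HasIIDIncrements` is stable under this operation. -/
lemma IsPoissonProcess.hasIIDIncrements_comp [IsProbabilityMeasure P] {X : ℝ≥0 → Ω → ℕ}
    (hX : IsPoissonProcess X lam P) {A : ℕ → Ω → ℕ} {μ : Measure ℕ}
    (hA : ∀ j, Measurable (A j)) (hmono : ∀ᵐ ω ∂P, Monotone fun j => A j ω)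
    (hind : IndepFun (fun ω j => A j ω) (fun ω t => X t ω) P) (hinc : HasIIDIncrements A μ P) :
    HasIIDIncrements (fun j ω => X (A j ω) ω) (poissonBind lam μ) P := by
  intro M F
  have hF : ∀ i, Measurable (F i) := fun i => .of_discrete
  have hAm : Measurable fun ω j => A j ω := measurable_pi_lambda _ hA
  have hXm : Measurable fun ω t => X t ω := measurable_pi_lambda _ hX.measurable
  have hmap := (indepFun_iff_map_prod_eq_prod_map_map hAm.aemeasurable hXm.aemeasurable).1 hind
  have hev : ∀ j, Measurable fun y : (ℕ → ℕ) × (ℝ≥0 → ℕ) => y.2 (y.1 j) := by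
    intro j
    have h1 : Measurable fun y : ℕ × (ℝ≥0 → ℕ) => y.2 y.1 :=
      measurable_from_prod_countable_right fun k => measurable_pi_apply (k : ℝ≥0)
    have h2 : Measurable fun y : (ℕ → ℕ) × (ℝ≥0 → ℕ) => (y.1 j, y.2) :=
      ((measurable_pi_apply j).comp measurable_fst).prodMk measurable_snd
    exact h1.comp h2
  have hΦ : Measurable fun y : (ℕ → ℕ) × (ℝ≥0 → ℕ) =>
      ∏ i ∈ Finset.range M, F i (y.2 (y.1 (i + 1)) - y.2 (y.1 i)) :=
    Finset.measurable_fun_prod _ fun i _ => (hF i).comp ((hev _).sub (hev _))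
  have : IsProbabilityMeasure (P.map fun ω t => X t ω) :=
    Measure.isProbabilityMeasure_map hXm.aemeasurable
  calc _ = ∫⁻ y, ∏ i ∈ Finset.range M, F i (y.2 (y.1 (i + 1)) - y.2 (y.1 i))
        ∂(P.map fun ω => ((fun j => A j ω), fun t => X t ω)) :=
        (lintegral_map hΦ (hAm.prodMk hXm)).symm
    _ = ∫⁻ ω, ∫⁻ ω', ∏ i ∈ Finset.range M, F i (X (A (i + 1) ω) ω' - X (A i ω) ω') ∂P ∂P := by
        rw [hmap, lintegral_prod _ hΦ.aemeasurable, lintegral_map hΦ.lintegral_prod_right' hAm]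
        refine lintegral_congr fun ω => ?_
        exact lintegral_map (hΦ.comp measurable_prodMk_left) hXm
    _ = ∫⁻ ω, ∏ i ∈ Finset.range M, ∫⁻ k, F i k
          ∂(poissonMeasure (lam * ((A (i + 1) ω - A i ω : ℕ) : ℝ≥0))) ∂P := by
        refine lintegral_congr_ae ?_
        filter_upwards [hmono] with ω hω
        rw [hX.lintegral_prod_increments (t := fun j => (A j ω : ℝ≥0))
          (fun i j hij => Nat.cast_le.2 (hω hij)) M F]
        refine Finset.prod_congr rfl fun i _ => ?_
        rw [Nat.cast_tsub]
    _ = _ := by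
        rw [hinc M fun i j => ∫⁻ k, F i k ∂(poissonMeasure (lam * (j : ℝ≥0)))]
        exact Finset.prod_congr rfl fun i _ => (lintegral_poissonBind μ (F i)).symm

lemma measurable_increment {A : ℕ → Ω → ℕ} (hA : ∀ j, Measurable (A j)) (i : ℕ) :
    Measurable fun ω => A (i + 1) ω - A i ω := (hA _).sub (hA _)

lemma HasIIDIncrements.measure_iInter {A : ℕ → Ω → ℕ} {μ : Measure ℕ} [IsProbabilityMeasure μ]
    (hA : ∀ j, Measurable (A j)) (hinc : HasIIDIncrements A μ P) (S : Finset ℕ) (s : ℕ → Set ℕ) :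
    P (⋂ i ∈ S, (fun ω => A (i + 1) ω - A i ω) ⁻¹' s i) = ∏ i ∈ S, μ (s i) := by
  have hSM : S ⊆ Finset.range (S.sup id + 1) := fun i hi =>
    Finset.mem_range.2 (Nat.lt_succ_of_le (Finset.le_sup (f := id) hi))
  -- Indices below the supremum but outside `S` receive the test function `1`.
  have h := hinc (S.sup id + 1) fun i => if i ∈ S then (s i).indicator 1 else 1
  have hm : MeasurableSet (⋂ i ∈ S, (fun ω => A (i + 1) ω - A i ω) ⁻¹' s i) :=
    Finset.measurableSet_biInter _ fun i _ => ((hA _).sub (hA _)) .of_discrete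
  rw [← lintegral_indicator_one hm]
  convert h using 1
  · refine lintegral_congr fun ω => ?_
    rw [← Finset.prod_subset hSM fun i _ hi => by simp [hi]]
    by_cases hω : ω ∈ ⋂ i ∈ S, (fun ω => A (i + 1) ω - A i ω) ⁻¹' s i
    · rw [indicator_of_mem hω]
      simp only [mem_iInter, mem_preimage] at hω
      exact (Finset.prod_eq_one fun i hi => by simp [hi, hω i hi]).symm
    · rw [indicator_of_notMem hω]
      simp only [mem_iInter, mem_preimage, not_forall] at hω
      obtain ⟨i, hi, hω⟩ := hω
      exact (Finset.prod_eq_zero hi (by simp [hi, hω])).symm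
  · rw [← Finset.prod_subset hSM fun i _ hi => by simp [hi]]
    refine Finset.prod_congr rfl fun i hi => ?_
    simp only [hi, if_true]
    exact (lintegral_indicator_one .of_discrete).symm

lemma HasIIDIncrements.map_eq {A : ℕ → Ω → ℕ} {μ : Measure ℕ} [IsProbabilityMeasure μ]
    (hA : ∀ j, Measurable (A j)) (hinc : HasIIDIncrements A μ P) (i : ℕ) :
    P.map (fun ω => A (i + 1) ω - A i ω) = μ := by
  ext s hs
  rw [Measure.map_apply (measurable_increment hA i) hs]
  simpa using hinc.measure_iInter hA {i} fun _ => s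

lemma HasIIDIncrements.iIndepFun {A : ℕ → Ω → ℕ} {μ : Measure ℕ} [IsProbabilityMeasure μ]
    (hA : ∀ j, Measurable (A j)) (hinc : HasIIDIncrements A μ P) :
    iIndepFun (fun i ω => A (i + 1) ω - A i ω) P := by
  rw [iIndepFun_iff_measure_inter_preimage_eq_mul]
  intro S s hs
  rw [hinc.measure_iInter hA S s]
  refine Finset.prod_congr rfl fun i hi => ?_
  rw [← hinc.map_eq hA i, Measure.map_apply (measurable_increment hA i) (hs i hi)]

variable {n : ℕ}

lemma indepFun_compositeProcess (hN : ∀ i < n, ∀ t, Measurable (N i t))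
    (hindep : iIndepFun (fun (i : Fin n) (ω : Ω) (t : ℝ≥0) => N i t ω) P) {m : ℕ} (hm : m + 1 < n)
    (τ : ℕ → ℝ≥0) :
    IndepFun (fun ω j => compositeProcess N m (τ j) ω) (fun ω t => N (m + 1) t ω) P := by
  classical
  let S : Finset (Fin n) := Finset.univ.filter fun i => (i : ℕ) ≤ m
  have hdisj : Disjoint S {⟨m + 1, hm⟩} := by simp [S]
  have h1 := hindep.indepFun_finset S {⟨m + 1, hm⟩} hdisj
    fun i => measurable_pi_lambda _ fun t => hN i i.2 t
  -- Canonical copy of the family on the path space of the first `m + 1` processes; it exhibits the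
  -- composite as a measurable function of those processes alone.
  let N' : ℕ → ℝ≥0 → (S → ℝ≥0 → ℕ) → ℕ := fun i t x =>
    if h : ∃ hi : i < n, (⟨i, hi⟩ : Fin n) ∈ S then x ⟨⟨i, h.1⟩, h.2⟩ t else 0
  have hN' : ∀ i t, Measurable (N' i t) := by
    intro i t
    by_cases h : ∃ hi : i < n, (⟨i, hi⟩ : Fin n) ∈ S
    · simp only [N', h, dite_true]
      exact (measurable_pi_apply t).comp (measurable_pi_apply _)
    · simp only [N', h, dite_false]
      exact measurable_const
  have heq : ∀ k ≤ m, ∀ t ω, compositeProcess N k t ω =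
      compositeProcess N' k t fun (i : S) t => N i t ω := by
    have hv : ∀ k ≤ m, ∀ t ω, N' k t (fun (i : S) t => N i t ω) = N k t ω := by
      intro k hk t ω
      have h : ∃ hi : k < n, (⟨k, hi⟩ : Fin n) ∈ S := ⟨by omega, by simp [S, hk]⟩
      simp only [N', h, dite_true]
    intro k hk t ω
    induction k with
    | zero => exact (hv 0 hk t ω).symm
    | succ k ih => rw [compositeProcess, compositeProcess, ih (by omega), hv _ hk]
  have h2 := h1.comp (φ := fun x j => compositeProcess N' m (τ j) x)
    (measurable_pi_lambda _ fun j => measurable_compositeProcess (fun i _ => hN' i) (τ j))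
    (measurable_pi_apply (⟨⟨m + 1, hm⟩, Finset.mem_singleton_self _⟩ : ({⟨m + 1, hm⟩} :
      Finset (Fin n))))
  have e : (fun ω j => compositeProcess N m (τ j) ω) =
      (fun x j => compositeProcess N' m (τ j) x) ∘ fun ω (i : S) t => N i t ω := by
    funext ω j
    exact heq m le_rfl _ _
  rw [e]
  exact h2

lemma hasIIDIncrements_compositeProcess [IsProbabilityMeasure P]
    (hN : ∀ i < n, IsPoissonProcess (N i) lam P)
    (hindep : iIndepFun (fun (i : Fin n) (ω : Ω) (t : ℝ≥0) => N i t ω) P) {m : ℕ} (hm : m < n)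
    (δ : ℝ≥0) :
    HasIIDIncrements (fun j => compositeProcess N m (j * δ)) (compositeLaw lam δ m) P := by
  induction m with
  | zero => exact (hN 0 hm).hasIIDIncrements δ
  | succ m ih =>
    refine (hN (m + 1) hm).hasIIDIncrements_comp (fun j => measurable_compositeProcess
      (fun i hi => (hN i (by omega)).measurable) _) ?_
      (indepFun_compositeProcess (fun i hi => (hN i hi).measurable) hindep hm _) (ih (by omega))
    have : ∀ᵐ ω ∂P, ∀ i, i < n → Monotone fun t => N i t ω :=
      ae_all_iff.2 fun i => by
        by_cases hi : i < n
        · filter_upwards [(hN i hi).monotone_paths] with ω hω _ using hω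
        · exact ae_of_all _ fun _ h => absurd h hi
    filter_upwards [this] with ω hω i j hij
    exact monotone_compositeProcess (fun i hi => hω i (by omega))
      (mul_le_mul_left (Nat.cast_le.2 hij) δ)

end Composite

/-! ### Inverse-power functionals of nondecreasing paths -/

/-- The integrand `(v t + a)⁻ᵖ`, for a path `v` and a starting level `a`. -/
noncomputable def inversePowerPath (v : ℝ≥0 → ℕ) (p : ℝ) (a : ℕ) (t : ℝ) : ℝ :=
  ((v t.toNNReal : ℝ) + a) ^ (-p)

section Path

variable {v : ℝ≥0 → ℕ} {p : ℝ} {a : ℕ}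

lemma inversePowerPath_nonneg (t : ℝ) : 0 ≤ inversePowerPath v p a t :=
  Real.rpow_nonneg (by positivity) _

lemma antitone_inversePowerPath (hv : Monotone v) (hp : 0 < p) (ha : 1 ≤ a) :
    Antitone (inversePowerPath v p a) := fun s t hst => by
  have h1 : (1 : ℝ) ≤ a := by exact_mod_cast ha
  refine Real.rpow_le_rpow_of_nonpos (by positivity) ?_ (by linarith)
  gcongr
  exact hv (Real.toNNReal_le_toNNReal hst)

lemma inversePowerPath_le (hp : 0 < p) {b : ℕ} (hb : 1 ≤ b) (hba : b ≤ a) (t : ℝ) :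
    inversePowerPath v p a t ≤ inversePowerPath v p b t := by
  have h1 : (1 : ℝ) ≤ b := by exact_mod_cast hb
  have h2 : (b : ℝ) ≤ a := by exact_mod_cast hba
  exact Real.rpow_le_rpow_of_nonpos (by positivity) (by linarith) (by linarith)

lemma inversePowerPath_mul (δ : ℝ≥0) (n : ℕ) :
    inversePowerPath v p a (δ * n) = ((v (n * δ) : ℝ) + a) ^ (-p) := by
  rw [inversePowerPath, show ((δ : ℝ) * n).toNNReal = n * δ by
    rw [← NNReal.coe_natCast, ← NNReal.coe_mul, Real.toNNReal_coe, mul_comm]]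

variable {f : ℝ → ℝ} {δ : ℝ}

lemma Antitone.integral_le_mul_tsum (hf : Antitone f) (hf0 : ∀ t, 0 ≤ f t) (hδ : 0 < δ)
    (hs : Summable fun n : ℕ => f (δ * n)) : ∫ t in Ioi 0, f t ≤ δ * ∑' n : ℕ, f (δ * n) := by
  have hg : Antitone fun t => f (δ * t) := hf.comp_monotone fun s t h => by
    gcongr
  have h := (hg.antitoneOn (Ici 0)).integral_le_tsum hs fun t _ => hf0 _
  rw [integral_comp_mul_left_Ioi f 0 hδ, mul_zero, smul_eq_mul] at h
  rwa [inv_mul_le_iff₀ hδ] at h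

lemma Antitone.summable_comp_mul (hf : Antitone f) (hf0 : ∀ t, 0 ≤ f t) (hδ : 0 < δ)
    (hi : IntegrableOn f (Ioi 0)) : Summable fun n : ℕ => f (δ * n) := by
  have hg : Antitone fun t => f (δ * t) := hf.comp_monotone fun s t h => by
    gcongr
  exact (hg.antitoneOn (Ici 0)).summable_of_integrableOn_Ioi_zero
    ((integrableOn_Ioi_comp_mul_left_iff f 0 hδ).2 (by rwa [mul_zero])) fun t _ => hf0 _

lemma Antitone.mul_tsum_le_add_integral (hf : Antitone f) (hf0 : ∀ t, 0 ≤ f t) (hδ : 0 < δ)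
    (hi : IntegrableOn f (Ioi 0)) :
    δ * ∑' n : ℕ, f (δ * n) ≤ δ * f 0 + ∫ t in Ioi 0, f t := by
  have hg : Antitone fun t => f (δ * t) := hf.comp_monotone fun s t h => by
    gcongr
  have h := (hg.antitoneOn (Ici 0)).tsum_le_integral
    ((integrableOn_Ioi_comp_mul_left_iff f 0 hδ).2 (by rwa [mul_zero])) fun t _ => hf0 _
  rw [integral_comp_mul_left_Ioi f 0 hδ, mul_zero, smul_eq_mul] at h
  have h' := mul_le_mul_of_nonneg_left h hδ.le
  rwa [mul_add, mul_inv_cancel_left₀ hδ.ne'] at h'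

/-- The left Riemann sum of step `d` lies between the integral and the integral plus `d * f 0`. -/
lemma Antitone.tendsto_mul_tsum (hf : Antitone f) (hf0 : ∀ t, 0 ≤ f t)
    (hi : IntegrableOn f (Ioi 0)) {d : ℕ → ℝ} (hd0 : ∀ i, 0 < d i)
    (hd : Tendsto d atTop (𝓝 0)) :
    Tendsto (fun i => d i * ∑' n : ℕ, f (d i * n)) atTop (𝓝 (∫ t in Ioi 0, f t)) := by
  refine tendsto_of_tendsto_of_tendsto_of_le_of_le tendsto_const_nhds
    (h := fun i => d i * f 0 + ∫ t in Ioi 0, f t) ?_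
    (fun i => hf.integral_le_mul_tsum hf0 (hd0 i) (hf.summable_comp_mul hf0 (hd0 i) hi))
    (fun i => hf.mul_tsum_le_add_integral hf0 (hd0 i) hi)
  simpa using (hd.mul_const (f 0)).add_const (∫ t in Ioi 0, f t)

end Path

/-! ### Functionals of processes with stationary independent increments -/

/-- `V` is a nondecreasing process with values in `ℕ`, started at `0`, with independent increments,
and with increments of law `L δ` over intervals of length `δ`. -/
structure IsMonotoneLevyProcess {Ω : Type*} [MeasurableSpace Ω] (V : ℝ≥0 → Ω → ℕ)
    (L : ℝ≥0 → Measure ℕ) (P : Measure Ω) : Prop where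
  measurable : ∀ t, Measurable (V t)
  monotone_paths : ∀ᵐ ω ∂P, Monotone fun t => V t ω
  start_zero : ∀ᵐ ω ∂P, V 0 ω = 0
  increments : ∀ δ : ℝ≥0, HasIIDIncrements (fun j => V (j * δ)) (L δ) P

/-- The functional `∫ (V t + a)⁻ᵖ dt`. -/
noncomputable def levelFunctional {Ω : Type*} (V : ℝ≥0 → Ω → ℕ) (p : ℝ) (a : ℕ) (ω : Ω) : ℝ :=
  ∫ t in Ioi (0 : ℝ), inversePowerPath (fun t => V t ω) p a t

/-- The Riemann sum, of step `δ`, of the functional `∫ (V t + a)⁻ᵖ dt`. -/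
noncomputable def levelRiemannSum {Ω : Type*} (V : ℝ≥0 → Ω → ℕ) (p : ℝ) (a : ℕ) (δ : ℝ≥0)
    (ω : Ω) : ℝ :=
  δ * ∑' n : ℕ, inversePowerPath (fun t => V t ω) p a (δ * n)

section Bounds

variable {Ω : Type*} {V : ℝ≥0 → Ω → ℕ} {p : ℝ}

lemma levelFunctional_nonneg (a : ℕ) (ω : Ω) : 0 ≤ levelFunctional V p a ω :=
  setIntegral_nonneg measurableSet_Ioi fun _ _ => inversePowerPath_nonneg _

lemma levelRiemannSum_nonneg (a : ℕ) (δ : ℝ≥0) (ω : Ω) : 0 ≤ levelRiemannSum V p a δ ω :=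
  mul_nonneg δ.2 (tsum_nonneg fun _ => inversePowerPath_nonneg _)

lemma norm_cexp_neg_mul_le {u : ℂ} (hu : 0 ≤ u.re) {x : ℝ} (hx : 0 ≤ x) :
    ‖Complex.exp (-u * x)‖ ≤ 1 := by
  rw [Complex.norm_exp, Real.exp_le_one_iff]
  simp only [Complex.mul_re, Complex.neg_re, Complex.ofReal_re, Complex.ofReal_im, mul_zero,
    sub_zero]
  nlinarith [mul_nonneg hu hx]

lemma continuous_cexp_neg_mul (u : ℂ) : Continuous fun x : ℝ => Complex.exp (-u * x) := by
  fun_prop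

end Bounds

/-! ### Finiteness of the functional and its Riemann sums. -/

namespace IsMonotoneLevyProcess

lemma ae_sum_increments {Ω : Type*} [MeasurableSpace Ω] {P : Measure Ω} {V : ℝ≥0 → Ω → ℕ}
    {L : ℝ≥0 → Measure ℕ} (hV : IsMonotoneLevyProcess V L P) (δ : ℝ≥0) :
    ∀ᵐ ω ∂P, ∀ j : ℕ, ∑ i ∈ Finset.range j, (V ((i + 1 : ℕ) * δ) ω - V (i * δ) ω) =
      V (j * δ) ω := by
  filter_upwards [hV.monotone_paths, hV.start_zero] with ω hω h0 j
  have hm : Monotone fun i : ℕ => V (i * δ) ω := fun i j hij =>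
    hω (mul_le_mul_left (Nat.cast_le.2 hij) δ)
  have h := Finset.sum_range_tsub hm j
  simp only [Nat.cast_zero, zero_mul, h0, tsub_zero] at h
  exact h

variable {Ω : Type*} [MeasurableSpace Ω] {P : Measure Ω} [IsProbabilityMeasure P]
  {V : ℝ≥0 → Ω → ℕ} {L : ℝ≥0 → Measure ℕ} [∀ δ, IsProbabilityMeasure (L δ)] {p : ℝ}

lemma measurable_inversePowerPath (hV : ∀ t, Measurable (V t)) (a : ℕ) (t : ℝ) :
    Measurable fun ω => inversePowerPath (fun t => V t ω) p a t :=
  (Measurable.of_discrete (f := fun k : ℕ => ((k : ℝ) + a) ^ (-p))).comp (hV _)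

lemma measurable_levelRiemannSum (hV : ∀ t, Measurable (V t)) (a : ℕ) (δ : ℝ≥0) :
    Measurable (levelRiemannSum V p a δ) :=
  (Measurable.tsum fun n => measurable_inversePowerPath hV a (δ * (n : ℕ))).const_mul _

/-- Sampling at integer times gives a random walk, and `ae_summable_comp_walk` applies to `(k +
1)⁻ᵖ`; monotonicity passes from the sum to the integral, and from starting level `1` to all others.
-/
lemma ae_integrableOn (hV : IsMonotoneLevyProcess V L P) (hL : L 1 {0}ᶜ ≠ 0) (hp : 1 < p) :
    ∀ᵐ ω ∂P, ∀ a : ℕ, 1 ≤ a →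
      IntegrableOn (inversePowerPath (fun t => V t ω) p a) (Ioi 0) := by
  have hm : ∀ j : ℕ, Measurable (V (j * 1)) := fun j => hV.measurable _
  have hs := ae_summable_comp_walk (f := fun k => ((k : ℝ) + 1) ^ (-p))
    (measurable_increment hm) ((hV.increments 1).iIndepFun hm) ((hV.increments 1).map_eq hm) hL
    (fun k => Real.rpow_nonneg (by positivity) _) (by
      refine (summable_succ_rpow_inv hp).congr fun k => ?_
      rw [Real.rpow_neg (by positivity)]; push_cast; rfl)
  filter_upwards [hs, hV.ae_sum_increments 1, hV.monotone_paths] with ω h1 h2 h3 a ha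
  have hp0 : 0 < p := by linarith
  simp only [h2] at h1
  refine ((antitone_inversePowerPath h3 hp0 ha).antitoneOn _).integrableOn_Ioi_zero_of_summable ?_
    fun t _ => inversePowerPath_nonneg t
  refine Summable.of_nonneg_of_le (fun n => inversePowerPath_nonneg _)
    (fun n => inversePowerPath_le hp0 le_rfl ha _) ?_
  refine h1.congr fun n => ?_
  have := inversePowerPath_mul (v := fun t => V t ω) (p := p) (a := 1) 1 n
  simp only [NNReal.coe_one, one_mul, Nat.cast_one] at this
  exact this.symm

lemma ae_tendsto_levelRiemannSum (hV : IsMonotoneLevyProcess V L P) (hL : L 1 {0}ᶜ ≠ 0)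
    (hp : 1 < p) {δ : ℕ → ℝ≥0} (hδ0 : ∀ i, 0 < δ i) (hδ : Tendsto δ atTop (𝓝 0)) :
    ∀ᵐ ω ∂P, ∀ a : ℕ, 1 ≤ a → Tendsto (fun i => levelRiemannSum V p a (δ i) ω) atTop
      (𝓝 (levelFunctional V p a ω)) := by
  filter_upwards [hV.ae_integrableOn hL hp, hV.monotone_paths] with ω h1 h2 a ha
  exact (antitone_inversePowerPath h2 (by linarith) ha).tendsto_mul_tsum
    inversePowerPath_nonneg (h1 a ha) (fun i => by exact_mod_cast hδ0 i) (by
      simpa using NNReal.tendsto_coe.2 hδ)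

lemma aemeasurable_levelFunctional (hV : IsMonotoneLevyProcess V L P) (hL : L 1 {0}ᶜ ≠ 0)
    (hp : 1 < p) {a : ℕ} (ha : 1 ≤ a) : AEMeasurable (levelFunctional V p a) P := by
  have hδ : Tendsto (fun i : ℕ => (1 : ℝ≥0) / (i + 1)) atTop (𝓝 0) :=
    tendsto_one_div_add_atTop_nhds_zero_nat
  refine aemeasurable_of_tendsto_metrizable_ae (atTop : Filter ℕ)
    (f := fun i : ℕ => levelRiemannSum V p a ((1 : ℝ≥0) / (i + 1)))
    (fun i => (measurable_levelRiemannSum hV.measurable a _).aemeasurable) ?_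
  filter_upwards [hV.ae_tendsto_levelRiemannSum hL hp
    (δ := fun i : ℕ => (1 : ℝ≥0) / (i + 1)) (fun i => by positivity) hδ] with ω hω
  exact hω a ha

lemma tendsto_integral_levelRiemannSum (hV : IsMonotoneLevyProcess V L P) (hL : L 1 {0}ᶜ ≠ 0)
    (hp : 1 < p) {δ : ℕ → ℝ≥0} (hδ0 : ∀ i, 0 < δ i) (hδ : Tendsto δ atTop (𝓝 0)) {u : ℂ}
    (hu : 0 ≤ u.re) {a : ℕ} (ha : 1 ≤ a) :
    Tendsto (fun i => ∫ ω, Complex.exp (-u * levelRiemannSum V p a (δ i) ω) ∂P) atTop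
      (𝓝 (∫ ω, Complex.exp (-u * levelFunctional V p a ω) ∂P)) := by
  refine tendsto_integral_of_dominated_convergence (fun _ => 1)
    (fun i => ((continuous_cexp_neg_mul u).measurable.comp
      (measurable_levelRiemannSum hV.measurable a _)).aestronglyMeasurable) (integrable_const _)
    (fun i => ae_of_all _ fun ω => norm_cexp_neg_mul_le hu (levelRiemannSum_nonneg _ _ _)) ?_
  filter_upwards [hV.ae_tendsto_levelRiemannSum hL hp hδ0 hδ] with ω hω
  exact ((continuous_cexp_neg_mul u).tendsto _).comp (hω a ha)

/-- First-step analysis: the `n = 0` term is deterministic and the rest starts afresh from `a + V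
δ`. The expectation is the limit of the iterates of `walkOp` on `1`, hence is fixed by one more
application. -/
lemma integral_levelRiemannSum_eq (hV : IsMonotoneLevyProcess V L P) (hL : L 1 {0}ᶜ ≠ 0)
    (hp : 1 < p) {δ : ℝ≥0} (hδ : 0 < δ) {u : ℂ} (hu : 0 ≤ u.re) {a : ℕ} (ha : 1 ≤ a) :
    ∫ ω, Complex.exp (-u * levelRiemannSum V p a δ ω) ∂P =
      Complex.exp (-u * (δ * (a : ℝ) ^ (-p) : ℝ)) *
        ∫ k, (∫ ω, Complex.exp (-u * levelRiemannSum V p (a + k) δ ω) ∂P) ∂(L δ) := by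
  set g : ℕ → ℂ := fun b => Complex.exp (-u * (δ * (b : ℝ) ^ (-p) : ℝ)) with hg
  have hg1 : ∀ b, ‖g b‖ ≤ 1 := fun b => norm_cexp_neg_mul_le hu (by positivity)
  have hm : ∀ j : ℕ, Measurable (V (j * δ)) := fun j => hV.measurable _
  have hit : ∀ M, ∀ b, ‖(walkOp g (L δ))^[M] (fun _ => 1) b‖ ≤ 1 := by
    intro M
    induction M with
    | zero => intro b; simp
    | succ M ih =>
      intro b
      rw [Function.iterate_succ_apply']
      simpa using norm_walkOp_le hg1 ih b
  have hlim : ∀ b, 1 ≤ b → Tendsto (fun M => (walkOp g (L δ))^[M] (fun _ => 1) b) atTop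
      (𝓝 (∫ ω, Complex.exp (-u * levelRiemannSum V p b δ ω) ∂P)) := by
    intro b hb
    have hwalk := fun M => integral_prod_walk (measurable_increment hm)
      ((hV.increments δ).iIndepFun hm) ((hV.increments δ).map_eq hm) hg1 b M
      (h := fun _ => 1) (B' := 1) (by simp)
    simp only [mul_one] at hwalk
    simp only [← hwalk]
    refine tendsto_integral_of_dominated_convergence (fun _ => 1) (fun M => ?_)
      (integrable_const _) (fun M => ae_of_all _ fun ω => ?_) ?_
    · refine (Finset.measurable_fun_prod _ fun i _ => ?_).aestronglyMeasurable
      exact (Measurable.of_discrete (f := fun k => g (b + k))).comp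
        (Finset.measurable_fun_sum _ fun j _ => measurable_increment hm j)
    · rw [norm_prod]
      exact Finset.prod_le_one (fun _ _ => norm_nonneg _) fun _ _ => hg1 _
    · filter_upwards [hV.ae_sum_increments δ, hV.ae_integrableOn hL hp, hV.monotone_paths]
        with ω h1 h2 h3
      simp only [h1]
      have hs := (antitone_inversePowerPath (p := p) h3 (by linarith) hb).summable_comp_mul
        inversePowerPath_nonneg (δ := δ) (by exact_mod_cast hδ) (h2 b hb)
      have ht := (hs.hasSum.tendsto_sum_nat.const_mul (δ : ℝ))
      refine (((continuous_cexp_neg_mul u).tendsto _).comp ht).congr fun M => ?_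
      simp only [Function.comp_apply, hg]
      rw [← Complex.exp_sum, ← Finset.mul_sum, ← Complex.ofReal_sum, ← Finset.mul_sum]
      simp only [inversePowerPath_mul]
      push_cast
      simp only [add_comm]
  have h1 := (tendsto_add_atTop_iff_nat 1).2 (hlim a ha)
  refine tendsto_nhds_unique h1 ?_
  simp only [Function.iterate_succ_apply']
  refine Tendsto.const_mul _ ?_
  exact tendsto_integral_of_dominated_convergence (fun _ => 1)
    (fun M => StronglyMeasurable.of_discrete.aestronglyMeasurable) (integrable_const _)
    (fun M => ae_of_all _ fun k => hit M _) (ae_of_all _ fun k => hlim _ (by omega))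

lemma tendsto_integral_levelFunctional_atTop (hV : IsMonotoneLevyProcess V L P)
    (hL : L 1 {0}ᶜ ≠ 0) (hp : 1 < p) {u : ℂ} (hu : 0 ≤ u.re) :
    Tendsto (fun a => ∫ ω, Complex.exp (-u * levelFunctional V p a ω) ∂P) atTop (𝓝 1) := by
  have h1 : (1 : ℂ) = ∫ _ : Ω, 1 ∂P := by simp
  rw [h1]
  refine (tendsto_add_atTop_iff_nat 1).1 (tendsto_integral_of_dominated_convergence (fun _ => 1)
    (fun a => ((continuous_cexp_neg_mul u).measurable.comp_aemeasurable
      (hV.aemeasurable_levelFunctional hL hp (Nat.succ_pos a))).aestronglyMeasurable)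
    (integrable_const _)
    (fun i => ae_of_all _ fun ω => norm_cexp_neg_mul_le hu (levelFunctional_nonneg _ _)) ?_)
  filter_upwards [hV.ae_integrableOn hL hp, hV.monotone_paths] with ω hω hmono
  have hp0 : 0 < p := by linarith
  have hf : Tendsto (fun a : ℕ => levelFunctional V p (a + 1) ω) atTop (𝓝 0) := by
    have h0 : (0 : ℝ) = ∫ t in Ioi (0 : ℝ), (0 : ℝ) := by simp
    rw [h0]
    refine tendsto_integral_of_dominated_convergence
      (inversePowerPath (fun t => V t ω) p 1)
      (fun a => (antitone_inversePowerPath hmono hp0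
        (Nat.succ_pos a)).measurable.aestronglyMeasurable) (hω 1 le_rfl)
      (fun a => ae_of_all _ fun t => ?_) (ae_of_all _ fun t => ?_)
    · rw [Real.norm_of_nonneg (inversePowerPath_nonneg _)]
      exact inversePowerPath_le hp0 le_rfl (Nat.succ_pos a) t
    · refine (tendsto_rpow_neg_atTop hp0).comp (tendsto_atTop_add_const_left _ _ ?_)
      exact tendsto_natCast_atTop_atTop.comp (tendsto_add_atTop_nat 1)
  have := ((continuous_cexp_neg_mul u).tendsto _).comp hf
  simpa [Function.comp_def] using this

end IsMonotoneLevyProcess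

/-! ### The law of the functional in terms of the jump chain -/

section SmallTime

variable {lam : ℝ≥0}

lemma integral_poissonBind {μ : Measure ℕ} [IsProbabilityMeasure μ] {f : ℕ → ℂ} {B : ℝ}
    (hf : ∀ k, ‖f k‖ ≤ B) :
    ∫ k, f k ∂(poissonBind lam μ) = ∫ j, ∫ k, f k ∂(poissonMeasure (lam * j)) ∂μ := by
  let κ : Kernel ℕ ℕ := ⟨fun k => poissonMeasure (lam * k), .of_discrete⟩
  have h : poissonBind lam μ = (κ ∘ₖ Kernel.const Unit μ) () := by
    change μ.bind κ = _
    rw [Kernel.comp_apply, Kernel.const_apply]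
  have hi : Integrable f (poissonBind lam μ) :=
    Integrable.of_bound StronglyMeasurable.of_discrete.aestronglyMeasurable B (ae_of_all _ hf)
  rw [h] at hi ⊢
  rw [Kernel.integral_comp hi, Kernel.const_apply]
  rfl

lemma norm_integral_le_of_bound {α : Type*} [MeasurableSpace α] {μ : Measure α}
    [IsProbabilityMeasure μ] {f : α → ℂ} {B : ℝ} (hf : ∀ k, ‖f k‖ ≤ B) : ‖∫ k, f k ∂μ‖ ≤ B := by
  simpa using norm_integral_le_of_norm_le_const (μ := μ) (ae_of_all _ hf)

/-- Since `c i 0 = 0`, dividing by `δ` leaves weights of order `δ ^ k` at `k + 1`; only the single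
jump survives. -/
lemma tendsto_integral_poissonMeasure {δ : ℕ → ℝ≥0} (hδ0 : ∀ i, 0 < δ i)
    (hδ : Tendsto δ atTop (𝓝 0)) {c : ℕ → ℕ → ℂ} {c' : ℕ → ℂ} {B : ℝ} (h0 : ∀ i, c i 0 = 0)
    (hB : ∀ i k, ‖c i k‖ ≤ B) (hc : ∀ k, Tendsto (fun i => c i k) atTop (𝓝 (c' k))) :
    Tendsto (fun i => ((δ i : ℝ) : ℂ)⁻¹ * ∫ k, c i k ∂(poissonMeasure (lam * δ i))) atTop
      (𝓝 ((lam : ℝ) * c' 1)) := by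
  set w : ℝ → ℕ → ℝ := fun d k =>
    Real.exp (-(lam * d)) * ((lam : ℝ) ^ (k + 1) * d ^ k / (k + 1).factorial) with hw
  have hB0 : 0 ≤ B := (norm_nonneg _).trans (hB 0 0)
  have hδ' : Tendsto (fun i => (δ i : ℝ)) atTop (𝓝 0) := by
    simpa using NNReal.tendsto_coe.2 hδ
  have hint : ∀ i, ((δ i : ℝ) : ℂ)⁻¹ * ∫ k, c i k ∂(poissonMeasure (lam * δ i)) =
      ∑' k, (w (δ i) k : ℂ) * c i (k + 1) := by
    intro i
    have hi : Integrable (c i) (poissonMeasure (lam * δ i)) :=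
      Integrable.of_bound StronglyMeasurable.of_discrete.aestronglyMeasurable B
        (ae_of_all _ (hB i))
    have hs := hasSum_integral_poissonMeasure hi
    rw [← hs.tsum_eq, hs.summable.tsum_eq_zero_add, h0, smul_zero, zero_add, ← tsum_mul_left]
    refine tsum_congr fun k => ?_
    have hd : ((δ i : ℝ) : ℂ) ≠ 0 := by exact_mod_cast (hδ0 i).ne'
    rw [Complex.real_smul, hw]
    push_cast
    rw [mul_pow, pow_succ ((δ i : ℝ) : ℂ)]
    field_simp
  simp only [hint]
  have hlim : ((lam : ℝ) : ℂ) * c' 1 = ∑' k, (w 0 k : ℂ) * c' (k + 1) := by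
    rw [tsum_eq_single 0 (fun k hk => by simp [hw, hk])]
    simp [hw]
  rw [hlim]
  refine tendsto_tsum_of_dominated_convergence
    (bound := fun k => (lam : ℝ) ^ (k + 1) / (k + 1).factorial * B) ?_ (fun k => ?_) ?_
  · exact ((summable_nat_add_iff 1).2 (Real.summable_pow_div_factorial (lam : ℝ))).mul_right B
  · have hwc : Continuous fun d => w d k := by simp only [hw]; fun_prop
    exact ((Complex.continuous_ofReal.tendsto _).comp ((hwc.tendsto 0).comp hδ')).mul (hc (k + 1))
  · filter_upwards [hδ'.eventually_lt_const one_pos] with i hi k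
    have hd : (0 : ℝ) ≤ δ i := (δ i).2
    rw [norm_mul, Complex.norm_of_nonneg (by positivity)]
    refine mul_le_mul ?_ (hB i _) (norm_nonneg _) (by positivity)
    calc w (δ i) k ≤ 1 * ((lam : ℝ) ^ (k + 1) * 1 / (k + 1).factorial) := by
          simp only [hw]
          have h1 : Real.exp (-(lam * δ i)) ≤ 1 := Real.exp_le_one_iff.2 (by
            rw [neg_nonpos]; positivity)
          have h2 : (δ i : ℝ) ^ k ≤ 1 := pow_le_one₀ hd hi.le
          gcongr
      _ = _ := by ring

/-- Only the innermost process runs for the short time `δ`: it makes one jump at rate `lam`, and the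
other `m` then run from time `1`. The induction integrates out the outermost process, whose value at
time `0` is `0`, so vanishing at `0` is preserved. -/
lemma tendsto_integral_compositeLaw {δ : ℕ → ℝ≥0} (hδ0 : ∀ i, 0 < δ i)
    (hδ : Tendsto δ atTop (𝓝 0)) {B : ℝ} (m : ℕ) : ∀ {c : ℕ → ℕ → ℂ} {c' : ℕ → ℂ},
    (∀ i, c i 0 = 0) → (∀ i k, ‖c i k‖ ≤ B) →
    (∀ k, Tendsto (fun i => c i k) atTop (𝓝 (c' k))) →
    Tendsto (fun i => ((δ i : ℝ) : ℂ)⁻¹ * ∫ k, c i k ∂(compositeLaw lam (δ i) m)) atTop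
      (𝓝 ((lam : ℝ) * ∫ k, c' k ∂(iteratedLaw lam m))) := by
  induction m with
  | zero =>
    intro c c' h0 hB hc
    simpa [compositeLaw, iteratedLaw] using tendsto_integral_poissonMeasure hδ0 hδ h0 hB hc
  | succ m ih =>
    intro c c' h0 hB hc
    have hB' : ∀ k, ‖c' k‖ ≤ B := fun k => le_of_tendsto' (hc k).norm fun i => hB i k
    simp only [compositeLaw, iteratedLaw]
    rw [integral_poissonBind hB']
    simp only [fun i => integral_poissonBind (lam := lam) (μ := compositeLaw lam (δ i) m) (hB i)]
    refine ih (fun i => ?_) (fun i j => norm_integral_le_of_bound (hB i)) fun j => ?_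
    · have h : poissonMeasure 0 = Measure.dirac 0 := by
        refine Measure.ext_of_singleton fun k => ?_
        rw [poissonMeasure_singleton]
        rcases Nat.eq_zero_or_pos k with rfl | hk
        · simp
        · simp [hk.ne', hk.ne]
      rw [Nat.cast_zero, mul_zero, h, integral_dirac, h0]
    · exact tendsto_integral_of_dominated_convergence (fun _ => B)
        (fun i => StronglyMeasurable.of_discrete.aestronglyMeasurable) (integrable_const _)
        (fun i => ae_of_all _ (hB i)) (ae_of_all _ hc)

end SmallTime

/-! ### The generator equation and its iteration along the jump chain. -/

namespace IsMonotoneLevyProcess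

variable {Ω : Type*} [MeasurableSpace Ω] {P : Measure Ω} [IsProbabilityMeasure P]
  {V : ℝ≥0 → Ω → ℕ} {lam : ℝ≥0} {m : ℕ} {p : ℝ}

/-- The generator equation, as the limit of the one-step equation for Riemann sums divided by the
step. -/
lemma mul_integral_levelFunctional (hV : IsMonotoneLevyProcess V (compositeLaw lam · m) P)
    (hL : compositeLaw lam 1 m {0}ᶜ ≠ 0) (hp : 1 < p) {u : ℂ} (hu : 0 ≤ u.re) {a : ℕ}
    (ha : 1 ≤ a) {Φ : ℕ → ℂ}
    (hΦ : ∀ b, Φ b = ∫ ω, Complex.exp (-u * levelFunctional V p b ω) ∂P) :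
    u * ((a : ℝ) ^ (-p) : ℝ) * Φ a = (lam : ℝ) * ∫ k, (Φ (a + k) - Φ a) ∂(iteratedLaw lam m) := by
  set δ : ℕ → ℝ≥0 := fun i => (1 : ℝ≥0) / (i + 1) with hδdef
  have hδ0 : ∀ i, 0 < δ i := fun i => by positivity
  have hδ : Tendsto δ atTop (𝓝 0) := tendsto_one_div_add_atTop_nhds_zero_nat
  have hδ' : Tendsto (fun i => (δ i : ℝ)) atTop (𝓝 0) := by
    simpa using NNReal.tendsto_coe.2 hδ
  set Ψ : ℕ → ℕ → ℂ := fun i b => ∫ ω, Complex.exp (-u * levelRiemannSum V p b (δ i) ω) ∂P with hΨ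
  have hΨ1 : ∀ i b, ‖Ψ i b‖ ≤ 1 := fun i b =>
    norm_integral_le_of_bound fun ω => norm_cexp_neg_mul_le hu (levelRiemannSum_nonneg _ _ _)
  have hlim : ∀ b, 1 ≤ b → Tendsto (fun i => Ψ i b) atTop (𝓝 (Φ b)) := fun b hb => by
    rw [hΦ]
    exact hV.tendsto_integral_levelRiemannSum hL hp hδ0 hδ hu hb
  have h1 := tendsto_integral_compositeLaw (lam := lam) hδ0 hδ (B := 2) m
    (c := fun i k => Ψ i (a + k) - Ψ i a) (c' := fun k => Φ (a + k) - Φ a) (fun i => by simp)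
    (fun i k => (norm_sub_le _ _).trans (by linarith [hΨ1 i (a + k), hΨ1 i a]))
    (fun k => (hlim _ (by omega)).sub (hlim a ha))
  set A : ℝ := (a : ℝ) ^ (-p)
  set E : ℝ → ℂ := fun d => Complex.exp (-u * (d * A : ℝ)) with hE
  have hEd : HasDerivAt E (-u * A) 0 := by
    have h2 : HasDerivAt (fun d : ℝ => -u * (d * A : ℝ)) (-u * A) 0 := by
      have h3 : HasDerivAt (fun d : ℝ => d * A) (1 * A) 0 := (hasDerivAt_id _).mul_const A
      simpa using (h3.ofReal_comp).const_mul (-u)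
    simpa [hE] using h2.cexp
  have hslope : Tendsto (fun i => ((δ i : ℝ) : ℂ)⁻¹ * (E (δ i) - 1)) atTop (𝓝 (-u * A)) := by
    have h3 := hEd.tendsto_slope_zero.comp
      (tendsto_nhdsWithin_iff.2 ⟨hδ', Eventually.of_forall fun i =>
        show (δ i : ℝ) ≠ 0 by exact_mod_cast (hδ0 i).ne'⟩)
    refine h3.congr fun i => ?_
    simp [hE]
  have hE1 : Tendsto (fun i => E (δ i)) atTop (𝓝 1) := by
    have := (hEd.continuousAt.tendsto).comp hδ'
    simpa [hE, Function.comp_def] using this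
  have h4 := hE1.mul h1
  -- The one-step equation says `Ψ i a = E * ∫ Ψ i (a + k)`; subtracting `E * Ψ i a` leaves `(1 - E)
  -- * Ψ i a`.
  have h5 : ∀ i, E (δ i) * (((δ i : ℝ) : ℂ)⁻¹ * ∫ k, (Ψ i (a + k) - Ψ i a)
      ∂(compositeLaw lam (δ i) m)) = -(((δ i : ℝ) : ℂ)⁻¹ * (E (δ i) - 1)) * Ψ i a := by
    intro i
    have h6 : Ψ i a = E (δ i) * ∫ k, Ψ i (a + k) ∂(compositeLaw lam (δ i) m) :=
      hV.integral_levelRiemannSum_eq hL hp (hδ0 i) hu ha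
    have hi : Integrable (fun k => Ψ i (a + k)) (compositeLaw lam (δ i) m) :=
      Integrable.of_bound StronglyMeasurable.of_discrete.aestronglyMeasurable 1
        (ae_of_all _ fun k => hΨ1 i _)
    rw [integral_sub hi (integrable_const _)]
    simp only [integral_const, probReal_univ, one_smul]
    linear_combination (-((δ i : ℝ) : ℂ)⁻¹) * h6
  simp only [h5, one_mul] at h4
  have h7 := hslope.neg.mul (hlim a ha)
  have h8 := tendsto_nhds_unique h4 h7
  rw [h8]
  ring

lemma norm_inv_one_add_div_le {u : ℂ} (hu : 0 ≤ u.re) {x : ℝ} (hx : 0 ≤ x) :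
    ‖(1 + u / (x : ℂ))⁻¹‖ ≤ 1 := by
  rw [norm_inv]
  refine inv_le_one_of_one_le₀ (le_trans ?_ (Complex.re_le_norm _))
  rw [Complex.add_re, Complex.div_ofReal_re, Complex.one_re]
  have := div_nonneg hu hx
  linarith

/-- Null moves drop out of the generator equation, which can then be solved for `Φ a`; the prefactor
is the transform of the time spent at level `a`, weighted by `a⁻ᵖ`. -/
lemma integral_levelFunctional_eq (hV : IsMonotoneLevyProcess V (compositeLaw lam · m) P)
    (hlam : 0 < lam) (hL : compositeLaw lam 1 m {0}ᶜ ≠ 0) (hQ : iteratedLaw lam m {0}ᶜ ≠ 0)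
    (hp : 1 < p) {u : ℂ} (hu : 0 ≤ u.re) {a : ℕ} (ha : 1 ≤ a) {Φ : ℕ → ℂ}
    (hΦ : ∀ b, Φ b = ∫ ω, Complex.exp (-u * levelFunctional V p b ω) ∂P) :
    Φ a = (1 + u / ((lam * (iteratedLaw lam m).real {0}ᶜ * (a : ℝ) ^ p : ℝ) : ℂ))⁻¹ *
      ∫ z : ℕ+, Φ (a + z) ∂(jumpLaw (iteratedLaw lam m)) := by
  set μ := iteratedLaw lam m
  have hr : 0 < μ.real {0}ᶜ := ENNReal.toReal_pos hQ (measure_ne_top _ _)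
  have hlam' : (0 : ℝ) < lam := by exact_mod_cast hlam
  have := isProbabilityMeasure_jumpLaw hQ
  have hΦ1 : ∀ b, ‖Φ b‖ ≤ 1 := fun b => by
    rw [hΦ]
    exact norm_integral_le_of_bound fun ω => norm_cexp_neg_mul_le hu (levelFunctional_nonneg _ _)
  have h1 := hV.mul_integral_levelFunctional hL hp hu ha hΦ
  have h2 : ∫ k, (Φ (a + k) - Φ a) ∂μ = ∫ k in {0}ᶜ, (Φ (a + k) - Φ a) ∂μ := by
    rw [setIntegral_eq_integral_of_forall_compl_eq_zero]
    intro k hk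
    simp only [mem_compl_iff, mem_singleton_iff, not_not] at hk
    simp [hk]
  have h3 := integral_jumpLaw (μ := μ) fun k => Φ (a + k) - Φ a
  rw [← h2] at h3
  have hi : Integrable (fun z : ℕ+ => Φ (a + z)) (jumpLaw μ) :=
    Integrable.of_bound StronglyMeasurable.of_discrete.aestronglyMeasurable 1
      (ae_of_all _ fun k => hΦ1 _)
  rw [integral_sub hi (integrable_const _)] at h3
  simp only [integral_const, probReal_univ, one_smul, Complex.real_smul] at h3
  have hrc : ((μ.real {0}ᶜ : ℝ) : ℂ) ≠ 0 := by exact_mod_cast hr.ne'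
  have hlc : ((lam : ℝ) : ℂ) ≠ 0 := by exact_mod_cast hlam'.ne'
  have ha0 : (0 : ℝ) < (a : ℝ) ^ p := Real.rpow_pos_of_pos (by exact_mod_cast ha) _
  have hac : (((a : ℝ) ^ p : ℝ) : ℂ) ≠ 0 := by exact_mod_cast ha0.ne'
  have hne : 1 + u / ((lam * μ.real {0}ᶜ * (a : ℝ) ^ p : ℝ) : ℂ) ≠ 0 := by
    intro h
    have h' := congrArg Complex.re h
    rw [Complex.add_re, Complex.div_ofReal_re, Complex.one_re, Complex.zero_re] at h'
    have : 0 ≤ u.re / (lam * μ.real {0}ᶜ * (a : ℝ) ^ p) := by positivity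
    linarith
  rw [eq_inv_mul_iff_mul_eq₀ hne]
  rw [Real.rpow_neg (Nat.cast_nonneg _)] at h1
  have h4 : ∫ k, (Φ (a + k) - Φ a) ∂μ = ((μ.real {0}ᶜ : ℝ) : ℂ) *
      (∫ z : ℕ+, Φ (a + z) ∂(jumpLaw μ) - Φ a) := by
    rw [h3]
    push_cast
    field_simp
  rw [h4] at h1
  push_cast at h1 ⊢
  have h5 : ∫ z : ℕ+, Φ (a + z) ∂(jumpLaw μ) = Φ a + u * (((a : ℝ) ^ p : ℝ) : ℂ)⁻¹ * Φ a /
      ((lam : ℝ) * (μ.real {0}ᶜ : ℝ)) := by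
    rw [h1]
    field_simp
    ring
  rw [h5]
  field_simp

/-- `Φ` is a fixed point of the weighted walk operator, so `Φ 1` equals the expected product times
`Φ (jumpLevel s K)` for every `K`. Levels tend to infinity, where `Φ → 1`, and the product is
bounded by `1`. -/
theorem tendsto_integral_prod_jumpRate (hV : IsMonotoneLevyProcess V (compositeLaw lam · m) P)
    (hlam : 0 < lam) (hL : compositeLaw lam 1 m {0}ᶜ ≠ 0) (hQ : iteratedLaw lam m {0}ᶜ ≠ 0)
    (hp : 1 < p) {u : ℂ} (hu : 0 ≤ u.re) :
    Tendsto (fun K => ∫ s, ∏ k ∈ Finset.range K,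
        (1 + u / (jumpRate (lam * (iteratedLaw lam m).real {0}ᶜ) p s k : ℂ))⁻¹
        ∂(Measure.infinitePi fun _ : ℕ => jumpLaw (iteratedLaw lam m))) atTop
      (𝓝 (∫ ω, Complex.exp (-u * levelFunctional V p 1 ω) ∂P)) := by
  set μ := iteratedLaw lam m
  have := isProbabilityMeasure_jumpLaw hQ
  set ν := Measure.infinitePi fun _ : ℕ => jumpLaw μ
  set Φ : ℕ → ℂ := fun b => ∫ ω, Complex.exp (-u * levelFunctional V p b ω) ∂P with hΦ
  have hΦ1 : ∀ b, ‖Φ b‖ ≤ 1 := fun b =>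
    norm_integral_le_of_bound fun ω => norm_cexp_neg_mul_le hu (levelFunctional_nonneg _ _)
  set c := lam * μ.real {0}ᶜ
  have hc : 0 ≤ c := by positivity
  set g : ℕ → ℂ := fun a => (1 + u / ((c * (a : ℝ) ^ p : ℝ) : ℂ))⁻¹ with hg
  have hg1 : ∀ a, ‖g a‖ ≤ 1 := fun a => norm_inv_one_add_div_le hu (by positivity)
  set μ' : Measure ℕ := (jumpLaw μ).map (fun z : ℕ+ => (z : ℕ))
  have : IsProbabilityMeasure μ' := Measure.isProbabilityMeasure_map Measurable.of_discrete.aemeasurable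
  have hfix : ∀ M, ∀ a, 1 ≤ a → (walkOp g μ')^[M] Φ a = Φ a := by
    intro M
    induction M with
    | zero => intro a _; rfl
    | succ M ih =>
      intro a ha
      rw [Function.iterate_succ_apply', walkOp, integral_map Measurable.of_discrete.aemeasurable
        StronglyMeasurable.of_discrete.aestronglyMeasurable]
      simp only [fun z : ℕ+ => ih (a + z) (by omega)]
      exact (hV.integral_levelFunctional_eq hlam hL hQ hp hu ha fun _ => rfl).symm
  have hYm : ∀ i, Measurable fun s : ℕ → ℕ+ => (s i : ℕ) := fun i =>
    (Measurable.of_discrete (f := fun z : ℕ+ => (z : ℕ))).comp (measurable_pi_apply i)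
  have hind : iIndepFun (fun (i : ℕ) (s : ℕ → ℕ+) => (s i : ℕ)) ν :=
    iIndepFun_infinitePi (P := fun _ : ℕ => jumpLaw μ) (X := fun _ (z : ℕ+) => (z : ℕ))
      fun _ => .of_discrete
  have hlaw : ∀ i, ν.map (fun s => (s i : ℕ)) = μ' := fun i => by
    have h := Measure.map_map (μ := ν) (g := fun z : ℕ+ => (z : ℕ)) .of_discrete
      (measurable_pi_apply i)
    rw [Measure.infinitePi_map_eval (fun _ : ℕ => jumpLaw μ) i] at h
    exact h.symm
  have hwalk : ∀ K, ∫ s, (∏ k ∈ Finset.range K, (1 + u / (jumpRate c p s k : ℂ))⁻¹) *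
      Φ (jumpLevel s K) ∂ν = Φ 1 := by
    intro K
    rw [← hfix K 1 le_rfl, ← integral_prod_walk (P := ν) (Y := fun i s => (s i : ℕ)) hYm hind hlaw hg1
      1 K hΦ1]
    simp only [hg, jumpRate, jumpLevel, add_comm 1]
  have hprod : ∀ K s, ‖∏ k ∈ Finset.range K, (1 + u / (jumpRate c p s k : ℂ))⁻¹‖ ≤ 1 := by
    intro K s
    rw [norm_prod]
    refine Finset.prod_le_one (fun _ _ => norm_nonneg _) fun k _ =>
      norm_inv_one_add_div_le hu (mul_nonneg hc (Real.rpow_nonneg (Nat.cast_nonneg _) _))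
  have hpm : ∀ K, Measurable fun s =>
      ∏ k ∈ Finset.range K, (1 + u / (jumpRate c p s k : ℂ))⁻¹ := fun K =>
    Finset.measurable_fun_prod _ fun k _ => (measurable_const.add (measurable_const.div
      (Complex.measurable_ofReal.comp (measurable_jumpRate k)))).inv
  have hlm : ∀ K, Measurable fun s => Φ (jumpLevel s K) := fun K =>
    (Measurable.of_discrete (f := fun k => Φ (k + 1))).comp
      (Finset.measurable_fun_sum _ fun j _ => hYm j)
  have hdiff : Tendsto (fun K => ∫ s, (∏ k ∈ Finset.range K,
      (1 + u / (jumpRate c p s k : ℂ))⁻¹) * (Φ (jumpLevel s K) - 1) ∂ν) atTop (𝓝 0) := by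
    have h0 : (0 : ℂ) = ∫ _ : ℕ → ℕ+, 0 ∂ν := by simp
    rw [h0]
    refine tendsto_integral_of_dominated_convergence (fun _ => 2)
      (fun K => ((hpm K).mul ((hlm K).sub_const 1)).aestronglyMeasurable) (integrable_const _)
      (fun K => ae_of_all _ fun s => ?_) (ae_of_all _ fun s => ?_)
    · rw [norm_mul]
      have h1 : ‖Φ (jumpLevel s K) - 1‖ ≤ 2 := (norm_sub_le _ _).trans (by
        rw [norm_one]; linarith [hΦ1 (jumpLevel s K)])
      calc _ ≤ 1 * 2 := mul_le_mul (hprod K s) h1 (norm_nonneg _) zero_le_one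
        _ = 2 := one_mul 2
    · have h1 : Tendsto (fun K => ‖Φ (jumpLevel s K) - 1‖) atTop (𝓝 0) := by
        have h2 := (hV.tendsto_integral_levelFunctional_atTop hL hp hu).comp
          (jumpLevel_strictMono s).tendsto_atTop
        have h3 := (h2.sub_const 1).norm
        rw [sub_self, norm_zero] at h3
        exact h3
      refine squeeze_zero_norm (fun K => ?_) h1
      rw [norm_mul]
      exact mul_le_of_le_one_left (norm_nonneg _) (hprod K s)
  have hint : ∀ K, Integrable (fun s => (∏ k ∈ Finset.range K,
      (1 + u / (jumpRate c p s k : ℂ))⁻¹) * Φ (jumpLevel s K)) ν := fun K =>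
    Integrable.of_bound ((hpm K).mul (hlm K)).aestronglyMeasurable 1 (ae_of_all _ fun s => by
      rw [norm_mul]
      exact mul_le_one₀ (hprod K s) (norm_nonneg _) (hΦ1 _))
  have hint' : ∀ K, Integrable (fun s => ∏ k ∈ Finset.range K,
      (1 + u / (jumpRate c p s k : ℂ))⁻¹) ν := fun K =>
    Integrable.of_bound (hpm K).aestronglyMeasurable 1 (ae_of_all _ (hprod K))
  have hfinal := hdiff.const_sub (Φ 1)
  rw [sub_zero] at hfinal
  refine hfinal.congr fun K => ?_
  rw [← hwalk K]
  simp only [mul_sub, mul_one]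
  rw [integral_sub (hint K) (hint' K)]
  ring

end IsMonotoneLevyProcess

/-! ### The iterated Poisson process -/

section IteratedLaw

variable {lam : ℝ≥0}

lemma poissonBind_apply (μ : Measure ℕ) (s : Set ℕ) :
    poissonBind lam μ s = ∫⁻ j, poissonMeasure (lam * (j : ℝ≥0)) s ∂μ :=
  Measure.bind_apply .of_discrete Measurable.of_discrete.aemeasurable

/-- A Poisson law with positive parameter charges `1`, so positivity passes to the next iterate. -/
lemma iteratedLaw_compl_zero_ne_zero (hlam : 0 < lam) (m : ℕ) : iteratedLaw lam m {0}ᶜ ≠ 0 := by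
  induction m with
  | zero => simp [iteratedLaw]
  | succ m ih =>
    intro h
    rw [iteratedLaw, poissonBind_apply, lintegral_eq_zero_iff .of_discrete] at h
    refine ih (measure_mono_null (t := {j | ¬poissonMeasure (lam * (j : ℝ≥0)) {0}ᶜ = 0})
      (fun j hj hj0 => ?_) (ae_iff.1 h))
    have hpos : 0 < lam * (j : ℝ≥0) :=
      mul_pos hlam (Nat.cast_pos.2 (Nat.pos_of_ne_zero hj))
    have h1 := poissonMeasure_real_singleton_pos 1 hpos
    have h2 : poissonMeasure (lam * (j : ℝ≥0)) {1} = 0 :=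
      measure_mono_null (by simp) hj0
    rw [measureReal_def, h2] at h1
    simp at h1

lemma hasSum_iteratedLaw_succ (m k : ℕ) :
    HasSum (fun j : ℕ => (lam : ℝ) ^ k / (k.factorial : ℝ) *
      ((j : ℝ) ^ k * Real.exp (-(lam * j)) * (iteratedLaw lam m).real {j}))
      ((iteratedLaw lam (m + 1)).real {k}) := by
  have h : iteratedLaw lam (m + 1) {k} =
      ∑' j : ℕ, poissonMeasure (lam * (j : ℝ≥0)) {k} * iteratedLaw lam m {j} := by
    rw [iteratedLaw, poissonBind_apply, lintegral_countable']
  rw [measureReal_def, h]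
  have hs := ENNReal.hasSum_toReal (h ▸ measure_ne_top (iteratedLaw lam (m + 1)) {k})
  rw [← ENNReal.tsum_toReal_eq fun j =>
    ENNReal.mul_ne_top (measure_ne_top _ _) (measure_ne_top _ _)] at hs
  convert hs using 2 with j
  rw [ENNReal.toReal_mul, ← measureReal_def, ← measureReal_def, poissonMeasure_real_singleton]
  push_cast
  ring

end IteratedLaw

lemma IsMonotoneLevyProcess.map_eq {Ω : Type*} [MeasurableSpace Ω] {P : Measure Ω}
    {V : ℝ≥0 → Ω → ℕ} {L : ℝ≥0 → Measure ℕ}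
    [∀ δ, IsProbabilityMeasure (L δ)] (hV : IsMonotoneLevyProcess V L P) (t : ℝ≥0) :
    P.map (V t) = L t := by
  rw [← (hV.increments t).map_eq (fun j => hV.measurable _) 0]
  refine Measure.map_congr ?_
  filter_upwards [hV.start_zero] with ω hω
  simp [hω]

section Functional

variable {Ω : Type*} {N : ℕ → ℝ≥0 → Ω → ℕ} {p : ℝ}

lemma inversePowerPath_compositeProcess (m : ℕ) (ω : Ω) (t : ℝ) :
    inversePowerPath (fun t => compositeProcess N m t ω) p 1 t =
      ((iteratedProcess N (m + 1) t.toNNReal ω : ℝ) + 1) ^ (-p) := by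
  rw [inversePowerPath, iteratedProcess_succ, Nat.cast_one, NNReal.coe_natCast]

lemma levelFunctional_compositeProcess (m : ℕ) :
    levelFunctional (compositeProcess N m) p 1 = inversePowerFunctional N (m + 1) p := by
  funext ω
  simp only [levelFunctional, inversePowerFunctional, inversePowerPath_compositeProcess]

end Functional

section IteratedProcess

variable {Ω : Type*} [MeasurableSpace Ω] {P : Measure Ω} [IsProbabilityMeasure P] {lam : ℝ≥0}
  {N : ℕ → ℝ≥0 → Ω → ℕ} {n : ℕ}

lemma isMonotoneLevyProcess_compositeProcess (hN : ∀ i < n, IsPoissonProcess (N i) lam P)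
    (hindep : iIndepFun (fun (i : Fin n) (ω : Ω) (t : ℝ≥0) => N i t ω) P) {m : ℕ} (hm : m < n) :
    IsMonotoneLevyProcess (compositeProcess N m) (compositeLaw lam · m) P where
  measurable := measurable_compositeProcess fun i hi => (hN i (by omega)).measurable
  monotone_paths := by
    have : ∀ᵐ ω ∂P, ∀ i : Fin n, Monotone fun t => N i t ω :=
      ae_all_iff.2 fun i => (hN i i.2).monotone_paths
    filter_upwards [this] with ω hω
    exact monotone_compositeProcess fun i hi => hω ⟨i, by omega⟩
  start_zero := by
    have : ∀ᵐ ω ∂P, ∀ i : Fin n, N i 0 ω = 0 := ae_all_iff.2 fun i => (hN i i.2).start_zero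
    filter_upwards [this] with ω hω
    exact compositeProcess_zero fun i hi => hω ⟨i, by omega⟩
  increments := hasIIDIncrements_compositeProcess hN hindep hm

lemma map_compositeProcess_one (hN : ∀ i < n, IsPoissonProcess (N i) lam P)
    (hindep : iIndepFun (fun (i : Fin n) (ω : Ω) (t : ℝ≥0) => N i t ω) P) {m : ℕ} (hm : m < n) :
    P.map (compositeProcess N m 1) = iteratedLaw lam (m + 1) := by
  rw [(isMonotoneLevyProcess_compositeProcess hN hindep hm).map_eq, compositeLaw_one]

lemma jumpProb_eq (hN : ∀ i < n, IsPoissonProcess (N i) lam P)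
    (hindep : iIndepFun (fun (i : Fin n) (ω : Ω) (t : ℝ≥0) => N i t ω) P) {m : ℕ} (hm : m ≤ n)
    (k : ℕ) : jumpProb N P m k = (iteratedLaw lam m).real {k} := by
  cases m with
  | zero =>
    rw [jumpProb, iteratedLaw]
    by_cases hk : k = 1
    · simp [iteratedProcess, hk, measureReal_def]
    · have : (1 : ℝ≥0) ≠ k := by exact_mod_cast Ne.symm hk
      simp [iteratedProcess, measureReal_def, this, Ne.symm hk]
  | succ m =>
    rw [jumpProb, ← map_compositeProcess_one hN hindep hm, map_measureReal_apply
      (measurable_compositeProcess (fun i hi => (hN i (by omega)).measurable) 1) .of_discrete]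
    congr 1
    ext ω
    simp [iteratedProcess_succ]

lemma jumpProbPos_eq (hN : ∀ i < n, IsPoissonProcess (N i) lam P)
    (hindep : iIndepFun (fun (i : Fin n) (ω : Ω) (t : ℝ≥0) => N i t ω) P) {m : ℕ} (hm : m ≤ n) :
    jumpProbPos N P m = (iteratedLaw lam m).real {0}ᶜ := by
  cases m with
  | zero => simp [jumpProbPos, iteratedProcess, iteratedLaw, measureReal_def]
  | succ m =>
    rw [jumpProbPos, ← map_compositeProcess_one hN hindep hm, map_measureReal_apply
      (measurable_compositeProcess (fun i hi => (hN i (by omega)).measurable) 1) .of_discrete]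
    congr 1
    ext ω
    simp [iteratedProcess_succ, Nat.one_le_iff_ne_zero]

end IteratedProcess

/-! ### Identification of the law and conclusion. -/

/-- A finite measure on `ℝ` is determined by its Laplace transform on the imaginary axis. -/
lemma map_eq_withDensity_of_integral_cexp {Ω : Type*} [MeasurableSpace Ω] {P : Measure Ω}
    [IsProbabilityMeasure P] {J : Ω → ℝ} (hJ : AEMeasurable J P) {ψ : ℝ → ℝ} (hψ : Measurable ψ)
    (hψ0 : ∀ x, 0 ≤ ψ x) (hψi : IntegrableOn ψ (Ioi 0))
    (h : ∀ t : ℝ, ∫ ω, Complex.exp (-(-(t * Complex.I)) * J ω) ∂P =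
      ∫ x in Ioi (0 : ℝ), Complex.exp (-(-(t * Complex.I)) * x) * (ψ x : ℂ)) :
    P.map J = (volume.restrict (Ioi 0)).withDensity fun x => ENNReal.ofReal (ψ x) := by
  have hfin : IsFiniteMeasure ((volume.restrict (Ioi (0 : ℝ))).withDensity
      fun x => ENNReal.ofReal (ψ x)) :=
    isFiniteMeasure_withDensity_ofReal hψi.2
  have : IsProbabilityMeasure (P.map J) := Measure.isProbabilityMeasure_map hJ
  refine Measure.ext_of_charFun (funext fun t => ?_)
  rw [charFun_apply_real, charFun_apply_real, integral_map hJ (by fun_prop),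
    integral_withDensity_eq_integral_toReal_smul hψ.ennreal_ofReal (by simp)]
  have h1 := h t
  simp only [neg_neg] at h1
  simp only [ENNReal.toReal_ofReal (hψ0 _), Complex.real_smul]
  convert h1 using 1
  · simp only [mul_assoc, mul_comm Complex.I]
  · refine integral_congr_ae (ae_of_all _ fun x => ?_)
    dsimp only
    rw [mul_comm, mul_right_comm]

theorem mainTheorem8 {Ω : Type*} [MeasurableSpace Ω] (P : Measure Ω) [IsProbabilityMeasure P]
    (n : ℕ) (hn : 1 ≤ n) (lam : ℝ≥0) (hlam : 0 < lam)
    (N : ℕ → ℝ≥0 → Ω → ℕ)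
    (hN : ∀ i < n, IsPoissonProcess (N i) lam P)
    (hindep : iIndepFun (fun (i : Fin n) (ω : Ω) (t : ℝ≥0) => N i t ω) P)
    (p : ℝ) (hp : 1 < p) :
    -- the law of `Z^{(m)}`, `m ≤ n - 1`: `Z^{(0)} = 1`, and the recurrence in `m`
    (∀ k : ℕ, jumpProb N P 0 k = if k = 1 then 1 else 0) ∧
    (∀ m : ℕ, m + 1 < n → ∀ k : ℕ,
      HasSum (fun j : ℕ => (lam : ℝ) ^ k / (k.factorial : ℝ) *
          ((j : ℝ) ^ k * Real.exp (-(lam * j)) * jumpProb N P m j))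
        (jumpProb N P (m + 1) k)) ∧
    0 < jumpProbPos N P (n - 1) ∧
    -- the functional is a.s. finite, and is a random variable
    (∀ᵐ ω ∂P, IntegrableOn
      (fun t : ℝ => ((iteratedProcess N n t.toNNReal ω : ℝ) + 1) ^ (-p)) (Ioi 0)) ∧
    AEMeasurable (inversePowerFunctional N n p) P ∧
    -- the Laplace transform
    (∀ u : ℂ, -(lam * jumpProbPos N P (n - 1)) < u.re →
      Integrable (fun ω => Complex.exp (-u * (inversePowerFunctional N n p ω : ℂ))) P ∧
      (∀ K : ℕ, Summable (fun z : Fin K → ℕ+ =>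
        laplaceTerm lam (jumpProb N P (n - 1)) (jumpProbPos N P (n - 1)) p u z)) ∧
      Tendsto
        (fun K : ℕ => ((jumpProbPos N P (n - 1) ^ (-(K : ℤ)) : ℝ) : ℂ) *
          ∑' z : Fin K → ℕ+,
            laplaceTerm lam (jumpProb N P (n - 1)) (jumpProbPos N P (n - 1)) p u z)
        atTop
        (𝓝 (∫ ω, Complex.exp (-u * (inversePowerFunctional N n p ω : ℂ)) ∂P))) ∧
    -- the density
    (∃ ψ : ℝ → ℝ, Measurable ψ ∧ (∀ x, 0 ≤ ψ x) ∧
      P.map (inversePowerFunctional N n p) =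
        (volume.restrict (Ioi 0)).withDensity (fun x => ENNReal.ofReal (ψ x)) ∧
      ∀ x : ℝ, 0 < x →
        (∀ K : ℕ, Summable (fun z : Fin K → ℕ+ =>
          densityTerm lam (jumpProb N P (n - 1)) (jumpProbPos N P (n - 1)) p x z)) ∧
        Tendsto
          (fun K : ℕ => (lam : ℝ) * (jumpProbPos N P (n - 1) ^ (1 - (K : ℤ)) *
            ∑' z : Fin K → ℕ+,
              densityTerm lam (jumpProb N P (n - 1)) (jumpProbPos N P (n - 1)) p x z))
          atTop (𝓝 (ψ x))) := by
  obtain ⟨m, rfl⟩ := Nat.exists_eq_add_of_le' hn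
  have hjp := fun {j : ℕ} (hj : j ≤ m + 1) (k : ℕ) => jumpProb_eq hN hindep hj k
  have hV := isMonotoneLevyProcess_compositeProcess hN hindep m.lt_succ_self
  have hQ := iteratedLaw_compl_zero_ne_zero hlam m
  have hL : compositeLaw lam 1 m {0}ᶜ ≠ 0 := by
    rw [compositeLaw_one]; exact iteratedLaw_compl_zero_ne_zero hlam (m + 1)
  have hq : jumpProb N P (m + 1 - 1) = fun k => (iteratedLaw lam m).real {k} :=
    funext (hjp m.le_succ)
  have hπ : jumpProbPos N P (m + 1 - 1) = (iteratedLaw lam m).real {0}ᶜ :=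
    jumpProbPos_eq hN hindep m.le_succ
  rw [hq, hπ]
  have hr : 0 < (iteratedLaw lam m).real {0}ᶜ := ENNReal.toReal_pos hQ (measure_ne_top _ _)
  set π := (iteratedLaw lam m).real {0}ᶜ with hπdef
  have hlam' : (0 : ℝ) < lam := by exact_mod_cast hlam
  have hc : 0 < lam * π := mul_pos hlam' hr
  have := isProbabilityMeasure_jumpLaw hQ
  obtain ⟨ψ, hψm, hψ0, hψx, hψL⟩ := exists_mixtureDensity
    (Measure.infinitePi fun _ : ℕ => jumpLaw (iteratedLaw lam m)) hc hp
  have hJm : AEMeasurable (inversePowerFunctional N (m + 1) p) P := by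
    rw [← levelFunctional_compositeProcess]
    exact hV.aemeasurable_levelFunctional hL hp le_rfl
  have hlaw : P.map (inversePowerFunctional N (m + 1) p) =
      (volume.restrict (Ioi 0)).withDensity fun x => ENNReal.ofReal (ψ x) := by
    refine map_eq_withDensity_of_integral_cexp hJm hψm hψ0 ?_ fun t => ?_
    · have h0 := (hψL 0 (by simpa using hc)).1.re
      simpa [IntegrableOn] using h0
    -- On the imaginary axis both limit theorems apply to the same sequence, so their limits
    -- coincide.
    · have ht : (-(t * Complex.I)).re = 0 := by simp
      have h1 := hV.tendsto_integral_prod_jumpRate hlam hL hQ hp ht.ge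
      rw [levelFunctional_compositeProcess] at h1
      exact tendsto_nhds_unique h1 (hψL _ (by rw [ht]; linarith)).2
  refine ⟨fun k => ?_, fun j hj k => ?_, hr, ?_, hJm, fun u hu => ?_,
    ψ, hψm, hψ0, hlaw, fun x hx => ?_⟩
  · rw [hjp (Nat.zero_le _), iteratedLaw]
    by_cases hk : k = 1
    · simp [hk, measureReal_def]
    · simp [hk, measureReal_def, Ne.symm hk]
  · simp only [hjp hj.le, hjp (j.le_succ.trans hj.le)]
    exact hasSum_iteratedLaw_succ j k
  · filter_upwards [hV.ae_integrableOn hL hp] with ω hω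
    exact (hω 1 le_rfl).congr_fun (fun t _ => inversePowerPath_compositeProcess m ω t)
      measurableSet_Ioi
  -- Where `Re u < 0` the process argument is not available; integrability and the limit are
  -- transported from the density through `hlaw`.
  · obtain ⟨hi, ht⟩ := hψL u hu
    have hs := hasSum_laplaceTerm hQ hlam (zero_lt_one.trans hp) hu
    have hcont : Continuous fun x : ℝ => Complex.exp (-u * x) := by fun_prop
    have hsmul : (fun x => (ENNReal.ofReal (ψ x)).toReal • Complex.exp (-u * x)) =
        fun x : ℝ => Complex.exp (-u * x) * (ψ x : ℂ) := by
      funext x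
      rw [ENNReal.toReal_ofReal (hψ0 x), Complex.real_smul, mul_comm]
    refine ⟨?_, fun K => (hs K).summable, ?_⟩
    · rw [show (fun ω => Complex.exp (-u * (inversePowerFunctional N (m + 1) p ω : ℂ))) =
        (fun x : ℝ => Complex.exp (-u * x)) ∘ inversePowerFunctional N (m + 1) p from rfl,
        ← integrable_map_measure hcont.aestronglyMeasurable hJm, hlaw,
        integrable_withDensity_iff_integrable_smul' hψm.ennreal_ofReal (by simp), hsmul]
      exact hi
    · rw [← integral_map (f := fun x : ℝ => Complex.exp (-u * x)) hJm hcont.aestronglyMeasurable,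
        hlaw, integral_withDensity_eq_integral_toReal_smul hψm.ennreal_ofReal (by simp), hsmul]
      refine ht.congr fun K => ?_
      rw [(hs K).tsum_eq, ← mul_assoc, ← Complex.ofReal_mul, zpow_neg, zpow_natCast,
        inv_mul_cancel₀ (pow_ne_zero K hr.ne'), Complex.ofReal_one, one_mul]
  · have hs := hasSum_densityTerm hQ hlam hp hx.le
    simp only [← hπdef] at hs
    refine ⟨fun K => (hs K).summable, (hψx x hx).congr fun K => ?_⟩
    -- The constants cancel: `λ * π ^ (1 - K) * π ^ K * (λ π)⁻¹ = 1`.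
    rw [(hs K).tsum_eq, zpow_sub₀ hr.ne', zpow_one, zpow_natCast]
    field_simp
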